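/- Let $A$ be a finite alphabet with $|A|\ge 3$, let $A^*$ be the set of finite words over $A$, and let $\preccurlyeq$ be the (scattered) subword ordering on $A^*$: $u\preccurlyeq v$ if $u=u_1\cdots u_n$ and $v=v_0u_1v_1\cdots u_nv_n$ for some words $u_1,\dots,u_n,v_0,\dots,v_n$. Consider first-order logic over the structure $(A^*,\preccurlyeq,(w)_{w\in A^*})$, which has a constant symbol for every word. A $\Sigma_0$-formula and a $\Pi_0$-formula is a quantifier-free formula; for $i\ge 1$, a $\Sigma_i$-formula (resp. $\Pi_i$-formula) is a formula $\exists x_1\cdots\exists x_n\,\varphi$ (resp. $\forall x_1\cdots\forall x_n\,\varphi$) with $n\ge 0$ and $\varphi$ a $\Pi_{i-1}$-formula (resp. $\Sigma_{i-1}$-formula). A formula with free variables $x_1,\dots,x_k$ defines the relation $R\subseteq(A^*)^k$ of all tuples that satisfy it. Let $\Sigma_1^0$ be the class of recursively enumerable relations and, for $i\ge 2$, let $\Sigma_i^0$ be the class of relations that are recursively enumerable with an oracle for some relation in $\Sigma_{i-1}^0$ (words and tuples of words being coded effectively). Then for every $i\ge 1$, every $k\ge 0$ and every relation $R\subseteq(A^*)^k$,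 the relation $R$ is definable by a $\Sigma_i$-formula over $(A^*,\preccurlyeq,(w)_{w\in A^*})$ if and only if $R$ belongs to $\Sigma_i^0$. -/

import Mathlib

open FirstOrder

/-! ### First-order logic over the subword ordering -/

/-- The relation symbols of subword logic: one binary symbol. -/
inductive SubwordRel : ℕ → Type
  | subword : SubwordRel 2

/-- The first-order language with a single binary relation symbol. The language with a constant
symbol for every word over `A` is `subwordLanguage[[List A]]`. -/
def subwordLanguage : Language := ⟨fun _ => Empty, SubwordRel⟩

/-- The set of words `List A` as a structure: the binary relation symbol is interpreted as the
(scattered) subword ordering. In `subwordLanguage[[List A]]`, Mathlib interprets the constant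
symbol of a word as that word. -/
instance subwordStructure (A : Type*) : subwordLanguage.Structure (List A) where
  funMap := fun f => f.elim
  RelMap := fun r =>
    match r with
    | SubwordRel.subword => fun v => (v 0).Sublist (v 1)

/-- The two kinds of quantifiers. -/
inductive Quantifier : Type
  | ex
  | all

/-- The other kind of quantifier. -/
def Quantifier.dual : Quantifier → Quantifier
  | .ex => .all
  | .all => .ex

/-- `IsAlternating q i φ`: the formula `φ` is prenex, with `i` (possibly empty) blocks of equal
quantifiers whose kinds alternate, the outermost block being of kind `q`. At level `0` these are
the quantifier-free formulas; at level `i + 1` they consist of a block of `q`-quantifiers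
followed by a formula of level `i` for the dual kind. -/
inductive IsAlternating {L : Language} {α : Type*} :
    Quantifier → ℕ → ∀ {n : ℕ}, L.BoundedFormula α n → Prop
  | of_isQF {q : Quantifier} {n : ℕ} {φ : L.BoundedFormula α n} (h : φ.IsQF) :
      IsAlternating q 0 φ
  | of_dual {q : Quantifier} {i n : ℕ} {φ : L.BoundedFormula α n}
      (h : IsAlternating q.dual i φ) : IsAlternating q (i + 1) φ
  | ex {i n : ℕ} {φ : L.BoundedFormula α (n + 1)}
      (h : IsAlternating Quantifier.ex (i + 1) φ) : IsAlternating Quantifier.ex (i + 1) φ.ex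
  | all {i n : ℕ} {φ : L.BoundedFormula α (n + 1)}
      (h : IsAlternating Quantifier.all (i + 1) φ) : IsAlternating Quantifier.all (i + 1) φ.all

/-- The `Σ_i`-formulas. -/
def IsSigmaFormula {L : Language} {α : Type*} {n : ℕ} (i : ℕ) (φ : L.BoundedFormula α n) : Prop :=
  IsAlternating Quantifier.ex i φ

/-- The relation `R ⊆ (A^*)^k` is defined by a `Σ_i`-formula with free variables indexed by
`Fin k` over the words with the subword ordering and a constant for every word. -/
def SigmaDefinable {A : Type*} {k : ℕ} (i : ℕ) (R : Set (Fin k → List A)) : Prop :=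
  ∃ φ : subwordLanguage[[List A]].Formula (Fin k),
    IsSigmaFormula i φ ∧ ∀ v : Fin k → List A, v ∈ R ↔ φ.Realize v

/-! ### The arithmetical hierarchy -/

open Classical in
/-- The membership oracle of a set of natural numbers. -/
noncomputable def membershipOracle (T : Set ℕ) : ℕ →. ℕ :=
  fun n => Part.some (if n ∈ T then 1 else 0)

/-- `S` is recursively enumerable relative to `T`: it is the domain of a semi-decision procedure
that has access to the membership oracle of `T`. -/
def REIn (T S : Set ℕ) : Prop :=
  RecursiveIn {membershipOracle T} fun n => Part.assert (n ∈ S) fun _ => Part.some ()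

/-- The levels `Σ_i^0` of the arithmetical hierarchy for sets of natural numbers: `Σ_1^0` is
the class of recursively enumerable sets, and `Σ_i^0` for `i ≥ 2` is the class of sets that are
recursively enumerable with an oracle in `Σ_{i-1}^0`. (Level `0` is by convention the class of
decidable sets.) -/
def ArithmeticalSigma : ℕ → Set ℕ → Prop
  | 0, S => ComputablePred fun n => n ∈ S
  | 1, S => REPred fun n => n ∈ S
  | i + 2, S => ∃ T : Set ℕ, ArithmeticalSigma (i + 1) T ∧ REIn T S

/-- A set of elements of an effectively coded type, in particular a relation on words, belongs to
`Σ_i^0` if the set of the codes of its elements does. -/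
def InSigmaZero {α : Type*} [Primcodable α] (i : ℕ) (R : Set α) : Prop :=
  ArithmeticalSigma i (Encodable.encode '' R)

-- From formulas to computability: the subword ordering is primitive recursive, so quantifier-free
-- formulas define decidable relations. An existential block over the complement of a relation is an
-- unbounded search with that relation as oracle, so each block costs one level of the arithmetical
-- hierarchy (`SigDef.arithmeticalSigma`).
--
-- From computability to formulas: all computations have to be expressed by existential quantifiers
-- over subword constraints. Words p^m q p^k allow exponents to be compared, and pinching an
-- exponent between two such words yields equality and addition of letter counts (`block_pinch`,
-- `SigDef.count_eq`, `SigDef.count_add`). A third letter, used as a separator, then defines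
-- concatenation of words over two letters. Since a word is determined by its projections to pairs
-- of letters, concatenation is definable in general (`SigDef.eq_append`).
--
-- An existential formula cannot quantify universally over the steps of a computation. Therefore a
-- word a^n₁ b ⋯ a^nₖ b is read as a vector of numbers, and a relation between numbers is imposed in
-- all positions at once (`VecDef`). Pointwise addition comes from interleaving two vectors. A chain
-- X₀, …, Xₖ of vectors is stored in two long vectors S = X₀⋯Xₖ₋₁ and S' = X₁⋯Xₖ: the step relation
-- holds pointwise between them, and the equation X₀S' = SXₖ makes the steps fit together
-- (`reflTransGen_forall₂_iff`). So pointwise definability is preserved by transitive closure. This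
-- yields disjunction, multiplication, pairing, primitive recursion and minimisation, hence all
-- functions that are partial recursive in oracles with definable graphs
-- (`GraphDef.of_recursiveIn`).
--
-- To climb the hierarchy, a vector avoids a set S in every position iff it cannot be split around
-- an entry in S; this costs one negation (`VecDef.not_mem`). Thus the membership oracle of a set is
-- available one level above the set (`VecDef.mem_of_arithmeticalSigma`). Finally words are tied to
-- their numerical codes by computing, inside the logic, a number for each two-letter projection
-- (`SigDef.eq_enc_wordCode`, `SigDef.of_inSigmaZero`).

universe u

/-! ### A semantic description of the formula hierarchy -/

section Hierarchy

variable {A : Type u}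

/-- A relation on words with variables indexed by `ι` that is defined by a quantifier-free
formula. -/
def QFDef {ι : Type} (R : (ι → List A) → Prop) : Prop :=
  ∃ φ : subwordLanguage[[List A]].Formula ι, φ.IsQF ∧ ∀ v, φ.Realize v ↔ R v

/-- The semantic counterpart of `Σ_i`-formulas: at level `0` the quantifier-free definable
relations, at level `i + 1` the relations obtained from negations of relations of level `i` by a
finite block of existential quantifiers. -/
def SigDef : ℕ → ∀ {ι : Type}, ((ι → List A) → Prop) → Prop
  | 0, _, R => QFDef R
  | i + 1, ι, R => ∃ (κ : Type) (_ : Finite κ) (R' : (ι ⊕ κ → List A) → Prop),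
      SigDef i R' ∧ ∀ v, R v ↔ ∃ w : κ → List A, ¬ R' (Sum.elim v w)

variable {ι κ : Type} {R S : (ι → List A) → Prop} {i : ℕ}

theorem QFDef.not (h : QFDef R) : QFDef fun v => ¬ R v := by
  obtain ⟨φ, hφ, h⟩ := h
  exact ⟨φ.not, hφ.not, fun v => by
    beta_reduce; rw [← h v]; exact Language.Formula.realize_not⟩

theorem QFDef.and (hR : QFDef R) (hS : QFDef S) : QFDef fun v => R v ∧ S v := by
  obtain ⟨φ, hφ, h⟩ := hR
  obtain ⟨ψ, hψ, h'⟩ := hS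
  exact ⟨φ ⊓ ψ, hφ.inf hψ, fun v => by
    beta_reduce; rw [← h v, ← h' v]; exact Language.Formula.realize_inf⟩

theorem QFDef.or (hR : QFDef R) (hS : QFDef S) : QFDef fun v => R v ∨ S v := by
  obtain ⟨φ, hφ, h⟩ := hR
  obtain ⟨ψ, hψ, h'⟩ := hS
  exact ⟨φ ⊔ ψ, hφ.sup hψ, fun v => by
    beta_reduce; rw [← h v, ← h' v]; exact Language.Formula.realize_sup⟩

theorem QFDef.reindex (f : ι → κ) (h : QFDef R) : QFDef fun v : κ → List A => R (v ∘ f) := by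
  obtain ⟨φ, hφ, h⟩ := h
  refine ⟨Language.Formula.relabel f φ, hφ.relabel _, fun v => ?_⟩
  rw [Language.Formula.realize_relabel, h]

theorem SigDef.congr (h : SigDef i R) (e : ∀ v, S v ↔ R v) : SigDef i S := by
  rwa [show S = R from funext fun v => propext (e v)]

theorem SigDef.reindex (f : ι → κ) (h : SigDef i R) :
    SigDef i fun v : κ → List A => R (v ∘ f) := by
  induction i generalizing ι κ with
  | zero => exact QFDef.reindex f h
  | succ i ih =>
    obtain ⟨τ, hτ, R', hR', e⟩ := h
    refine ⟨τ, hτ, _, ih (Sum.map f id) hR', fun v => ?_⟩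
    beta_reduce
    rw [e]
    refine exists_congr fun w => ?_
    rw [Sum.elim_comp_map, Function.comp_id]

/-- Each level is an existential block over a complement, so conjunction at one level needs
disjunction at the previous one and vice versa. The two must go through the induction together. -/
theorem SigDef.and_or (hR : SigDef i R) (hS : SigDef i S) :
    SigDef i (fun v => R v ∧ S v) ∧ SigDef i (fun v => R v ∨ S v) := by
  induction i generalizing ι with
  | zero => exact ⟨QFDef.and hR hS, QFDef.or hR hS⟩
  | succ i ih =>
    obtain ⟨κ, hκ, R', hR', e⟩ := hR
    obtain ⟨τ, hτ, S', hS', e'⟩ := hS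
    have h := ih (hR'.reindex (Sum.map id (Sum.inl : κ → κ ⊕ τ)))
      (hS'.reindex (Sum.map id (Sum.inr : τ → κ ⊕ τ)))
    refine ⟨⟨κ ⊕ τ, inferInstance, _, h.2, fun v => ?_⟩,
      ⟨κ ⊕ τ, inferInstance, _, h.1, fun v => ?_⟩⟩
    · beta_reduce
      rw [e, e']
      constructor
      · rintro ⟨⟨w, hw⟩, ⟨w', hw'⟩⟩
        refine ⟨Sum.elim w w', ?_⟩
        simpa [Sum.elim_comp_map] using ⟨hw, hw'⟩
      · rintro ⟨w, hw⟩
        simp only [Sum.elim_comp_map, Function.comp_id, not_or] at hw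
        exact ⟨⟨_, hw.1⟩, ⟨_, hw.2⟩⟩
    · beta_reduce
      rw [e, e']
      constructor
      · rintro (⟨w, hw⟩ | ⟨w, hw⟩)
        -- The block of the disjunct that is not used is filled with empty words.
        · refine ⟨Sum.elim w fun _ => [], fun h => hw ?_⟩
          simpa [Sum.elim_comp_map] using h.1
        · refine ⟨Sum.elim (fun _ => []) w, fun h => hw ?_⟩
          simpa [Sum.elim_comp_map] using h.2
      · rintro ⟨w, hw⟩
        simp only [Sum.elim_comp_map, Function.comp_id, not_and_or] at hw
        exact hw.imp (fun h => ⟨_, h⟩) fun h => ⟨_, h⟩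

theorem SigDef.and (hR : SigDef i R) (hS : SigDef i S) : SigDef i fun v => R v ∧ S v :=
  (hR.and_or hS).1

theorem SigDef.or (hR : SigDef i R) (hS : SigDef i S) : SigDef i fun v => R v ∨ S v :=
  (hR.and_or hS).2

theorem SigDef.not (h : SigDef i R) : SigDef (i + 1) fun v => ¬ R v :=
  ⟨Empty, inferInstance, _, h.reindex Sum.inl, fun v => by simp⟩

theorem SigDef.succ (h : SigDef i R) : SigDef (i + 1) R := by
  induction i generalizing ι with
  | zero => exact (SigDef.not (i := 0) (QFDef.not h)).congr fun v => not_not.symm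
  | succ i ih =>
    obtain ⟨κ, hκ, R', hR', e⟩ := h
    exact ⟨κ, hκ, R', ih hR', e⟩

theorem SigDef.mono {j : ℕ} (h : SigDef i R) (hij : i ≤ j) : SigDef j R := by
  induction hij with
  | refl => exact h
  | step _ ih => exact ih.succ

theorem SigDef.exists_fun [Finite κ] {P : (ι → List A) → (κ → List A) → Prop}
    (h : SigDef (i + 1) fun v : ι ⊕ κ → List A => P (fun x => v (.inl x)) fun y => v (.inr y)) :
    SigDef (i + 1) fun v => ∃ w, P v w := by
  obtain ⟨τ, hτ, R', hR', e⟩ := h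
  refine ⟨κ ⊕ τ, inferInstance, _, hR'.reindex (Equiv.sumAssoc ι κ τ), fun v => ?_⟩
  have key : ∀ (w : κ → List A) (z : τ → List A),
      Sum.elim v (Sum.elim w z) ∘ Equiv.sumAssoc ι κ τ = Sum.elim (Sum.elim v w) z := by
    intro w z
    funext x
    rcases x with (x | x) | x <;> rfl
  constructor
  · rintro ⟨w, hw⟩
    obtain ⟨z, hz⟩ := (e (Sum.elim v w)).1 hw
    exact ⟨Sum.elim w z, by rwa [key]⟩
  · rintro ⟨w, hw⟩
    obtain ⟨w, z, rfl⟩ : ∃ w₁ w₂, w = Sum.elim w₁ w₂ :=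
      ⟨_, _, (Sum.elim_comp_inl_inr w).symm⟩
    rw [key] at hw
    exact ⟨w, (e (Sum.elim v w)).2 ⟨z, hw⟩⟩

theorem SigDef.ex {P : (ι → List A) → List A → Prop}
    (h : SigDef (i + 1) fun v : Option ι → List A => P (fun x => v (some x)) (v none)) :
    SigDef (i + 1) fun v => ∃ x, P v x := by
  have := h.reindex (κ := ι ⊕ Unit) fun o => o.elim (.inr ()) .inl
  refine (SigDef.exists_fun (κ := Unit) (P := fun v w => P v (w ())) this).congr fun v => ?_
  exact ⟨fun ⟨x, hx⟩ => ⟨fun _ => x, hx⟩, fun ⟨w, hw⟩ => ⟨_, hw⟩⟩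

theorem SigDef.true : SigDef i fun _ : ι → List A => True := by
  refine SigDef.mono (i := 0) ?_ (Nat.zero_le _)
  exact ⟨⊤, Language.BoundedFormula.IsQF.top, fun v => by simp⟩

theorem SigDef.false : SigDef i fun _ : ι → List A => False := by
  refine SigDef.mono (i := 0) ?_ (Nat.zero_le _)
  exact ⟨⊥, Language.BoundedFormula.isQF_bot, fun v => by simp⟩

theorem SigDef.prop (p : Prop) : SigDef i fun _ : ι → List A => p := by
  by_cases h : p
  · exact SigDef.true.congr fun _ => by simp [h]
  · exact SigDef.false.congr fun _ => by simp [h]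

theorem SigDef.forall_finite {β : Type*} [Finite β] {P : β → (ι → List A) → Prop}
    (h : ∀ b, SigDef i (P b)) : SigDef i fun v => ∀ b, P b v := by
  classical
  have := Fintype.ofFinite β
  have key : ∀ s : Finset β, SigDef i fun v => ∀ b ∈ s, P b v := by
    intro s
    induction s using Finset.induction_on with
    | empty => exact SigDef.true.congr fun v => by simp
    | insert b s _ ih => exact ((h b).and ih).congr fun v => by simp
  exact (key Finset.univ).congr fun v => by simp

/-! #### Atomic relations -/

/-- The term for a variable or a constant. -/
def wordTerm : ι ⊕ List A → subwordLanguage[[List A]].Term (ι ⊕ Fin 0)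
  | .inl x => Language.Term.var (.inl x)
  | .inr c => (subwordLanguage.con c).term

/-- The value of a variable or a constant. -/
def wordValue (v : ι → List A) : ι ⊕ List A → List A := Sum.elim v id

theorem realize_wordTerm (v : ι → List A) (xs : Fin 0 → List A) (s : ι ⊕ List A) :
    (wordTerm s).realize (Sum.elim v xs) = wordValue v s := by
  cases s with
  | inl x => rfl
  | inr c => exact Language.Term.realize_constants

/-- The symbol of the subword ordering in the language with constants. -/
def subwordSymbol : (subwordLanguage[[List A]]).Relations 2 :=
  Sum.inl (SubwordRel.subword : subwordLanguage.Relations 2)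

theorem QFDef.sublist (s t : ι ⊕ List A) :
    QFDef fun v => (wordValue v s).Sublist (wordValue v t) := by
  refine ⟨subwordSymbol.boundedFormula₂ (wordTerm s) (wordTerm t),
    (Language.BoundedFormula.IsAtomic.rel _ _).isQF, fun v => ?_⟩
  rw [Language.Formula.Realize, Language.BoundedFormula.realize_rel₂, realize_wordTerm,
    realize_wordTerm]
  exact Iff.rfl

theorem SigDef.sublist (x y : ι) : SigDef i fun v : ι → List A => (v x).Sublist (v y) :=
  SigDef.mono (i := 0) (QFDef.sublist (.inl x) (.inl y)) (Nat.zero_le _)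

theorem SigDef.not_sublist (x y : ι) : SigDef i fun v : ι → List A => ¬ (v x).Sublist (v y) :=
  SigDef.mono (i := 0) (QFDef.sublist (.inl x) (.inl y)).not (Nat.zero_le _)

theorem SigDef.const_sublist (c : List A) (x : ι) :
    SigDef i fun v : ι → List A => c.Sublist (v x) :=
  SigDef.mono (i := 0) (QFDef.sublist (.inr c) (.inl x)) (Nat.zero_le _)

theorem SigDef.const_not_sublist (c : List A) (x : ι) :
    SigDef i fun v : ι → List A => ¬ c.Sublist (v x) :=
  SigDef.mono (i := 0) (QFDef.sublist (.inr c) (.inl x)).not (Nat.zero_le _)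

theorem SigDef.sublist_const (c : List A) (x : ι) :
    SigDef i fun v : ι → List A => (v x).Sublist c :=
  SigDef.mono (i := 0) (QFDef.sublist (.inl x) (.inr c)) (Nat.zero_le _)

theorem SigDef.eq_const (c : List A) (x : ι) : SigDef i fun v : ι → List A => v x = c :=
  ((SigDef.sublist_const c x).and (SigDef.const_sublist c x)).congr fun _ =>
    ⟨fun h => by simp [h], fun h => h.1.antisymm h.2⟩

/-! #### Comparison with prenex formulas -/

theorem IsQF.toFormula {L : Language} {α : Type*} {n : ℕ} {φ : L.BoundedFormula α n}
    (h : φ.IsQF) : φ.toFormula.IsQF := by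
  induction h with
  | falsum => exact Language.BoundedFormula.isQF_bot
  | of_isAtomic h =>
    cases h with
    | equal t₁ t₂ => exact (Language.BoundedFormula.IsAtomic.equal _ _).isQF
    | rel r ts => exact (Language.BoundedFormula.IsAtomic.rel _ _).isQF
  | imp _ _ ih₁ ih₂ => exact ih₁.imp ih₂

theorem SigDef.exists_snoc {n : ℕ} {P : (ι → List A) → (Fin (n + 1) → List A) → Prop}
    (h : SigDef (i + 1) fun v : ι ⊕ Fin (n + 1) → List A => P (v ∘ .inl) (v ∘ .inr)) :
    SigDef (i + 1) fun v : ι ⊕ Fin n → List A => ∃ a, P (v ∘ .inl) (Fin.snoc (v ∘ .inr) a) := by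
  refine SigDef.ex ?_
  refine (h.reindex (κ := Option (ι ⊕ Fin n))
    (Sum.elim (fun x => some (.inl x)) (Fin.snoc (fun y => some (.inr y)) none))).congr
    fun v => Eq.to_iff ?_
  congr 1
  funext y
  refine Fin.lastCases ?_ (fun y => ?_) y <;> simp

/-- There is no separate class for the universal formulas: they are tracked through their negations,
which turns every dualisation step into `SigDef.not`. -/
theorem IsAlternating.sigDef {q : Quantifier} {n : ℕ}
    {φ : subwordLanguage[[List A]].BoundedFormula ι n} (h : IsAlternating q i φ) :
    match q with
    | .ex => SigDef i fun v : ι ⊕ Fin n → List A => φ.Realize (v ∘ .inl) (v ∘ .inr)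
    | .all => SigDef i fun v : ι ⊕ Fin n → List A => ¬ φ.Realize (v ∘ .inl) (v ∘ .inr) := by
  induction h with
  | @of_isQF q n φ h =>
    have h' : QFDef fun v : ι ⊕ Fin n → List A => φ.Realize (v ∘ .inl) (v ∘ .inr) :=
      ⟨φ.toFormula, IsQF.toFormula h, fun v => by
        rw [Language.BoundedFormula.realize_toFormula]⟩
    cases q with
    | ex => exact h'
    | all => exact h'.not
  | @of_dual q i n φ _ ih =>
    cases q with
    | ex => exact (SigDef.not ih).congr fun v => not_not.symm
    | all => exact SigDef.not ih
  | @ex i n φ _ ih =>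
    refine (SigDef.exists_snoc (P := fun v w => φ.Realize v w) ih).congr fun v => ?_
    exact Language.BoundedFormula.realize_ex
  | @all i n φ _ ih =>
    refine (SigDef.exists_snoc (P := fun v w => ¬ φ.Realize v w) ih).congr fun v => ?_
    rw [Language.BoundedFormula.realize_all, not_forall]

theorem IsAlternating.exists_block {i n : ℕ} (m : ℕ)
    {φ : subwordLanguage[[List A]].BoundedFormula ι (n + m)} :
    (IsAlternating .ex (i + 1) φ → ∃ ψ : subwordLanguage[[List A]].BoundedFormula ι n,
      IsAlternating .ex (i + 1) ψ ∧ ∀ (v : ι → List A) (xs : Fin n → List A),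
        ψ.Realize v xs ↔ ∃ ys : Fin m → List A, φ.Realize v (Fin.append xs ys)) ∧
    (IsAlternating .all (i + 1) φ → ∃ ψ : subwordLanguage[[List A]].BoundedFormula ι n,
      IsAlternating .all (i + 1) ψ ∧ ∀ (v : ι → List A) (xs : Fin n → List A),
        ψ.Realize v xs ↔ ∀ ys : Fin m → List A, φ.Realize v (Fin.append xs ys)) := by
  induction m with
  | zero =>
    have key (xs : Fin n → List A) (ys : Fin 0 → List A) : Fin.append xs ys = xs := by
      rw [Subsingleton.elim ys Fin.elim0, Fin.append_elim0]
      rfl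
    exact ⟨fun h => ⟨φ, h, fun v xs => by simp [key]⟩, fun h => ⟨φ, h, fun v xs => by simp [key]⟩⟩
  | succ m ih =>
    have key (xs : Fin n → List A) (ys : Fin m → List A) (a : List A) :
        (Fin.snoc (Fin.append xs ys) a : Fin (n + m + 1) → List A) =
          Fin.append xs (Fin.snoc ys a : Fin (m + 1) → List A) := by
      rw [Fin.append_snoc]
    constructor
    · intro h
      obtain ⟨ψ, hψ, e⟩ := (ih (φ := φ.ex)).1 (IsAlternating.ex h)
      refine ⟨ψ, hψ, fun v xs => ?_⟩
      rw [e]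
      simp only [Language.BoundedFormula.realize_ex, key]
      constructor
      · rintro ⟨ys, a, h⟩
        exact ⟨_, h⟩
      · rintro ⟨ys, h⟩
        exact ⟨Fin.init ys, ys (Fin.last m), by rwa [Fin.snoc_init_self]⟩
    · intro h
      obtain ⟨ψ, hψ, e⟩ := (ih (φ := φ.all)).2 (IsAlternating.all h)
      refine ⟨ψ, hψ, fun v xs => ?_⟩
      rw [e]
      simp only [Language.BoundedFormula.realize_all, key]
      constructor
      · intro h ys
        have := h (Fin.init ys) (ys (Fin.last m))
        rwa [Fin.snoc_init_self] at this
      · intro h ys a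
        exact h _

/-- The formula for the complement is carried along because the kernel of the next level is a
complement; the two halves swap roles at each step. -/
theorem SigDef.exists_formula {n : ℕ} {R : (ι ⊕ Fin n → List A) → Prop} (h : SigDef i R) :
    (∃ φ : subwordLanguage[[List A]].BoundedFormula ι n, IsAlternating .ex i φ ∧
      ∀ v xs, φ.Realize v xs ↔ R (Sum.elim v xs)) ∧
    (∃ φ : subwordLanguage[[List A]].BoundedFormula ι n, IsAlternating .all i φ ∧
      ∀ v xs, φ.Realize v xs ↔ ¬ R (Sum.elim v xs)) := by
  induction i generalizing n with
  | zero =>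
    obtain ⟨φ, hφ, e⟩ := h
    have key : ∀ (v : ι → List A) (xs : Fin n → List A),
        (Language.BoundedFormula.relabel (n := n) id φ).Realize v xs ↔ R (Sum.elim v xs) := by
      intro v xs
      rw [← e, Language.Formula.Realize, Language.BoundedFormula.realize_relabel]
      exact Eq.to_iff (congrArg _ (Subsingleton.elim _ _))
    have hqf : (Language.BoundedFormula.relabel (n := n) id φ).IsQF := hφ.relabel id
    exact ⟨⟨_, .of_isQF hqf, key⟩, ⟨_, .of_isQF hqf.not, fun v xs => by
      rw [← key]; exact Language.BoundedFormula.realize_not⟩⟩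
  | succ i ih =>
    obtain ⟨κ, hκ, R', hR', e⟩ := h
    obtain ⟨m, ⟨f⟩⟩ := Finite.exists_equiv_fin κ
    have hR'' := hR'.reindex (κ := ι ⊕ Fin (n + m))
      (Sum.elim (Sum.elim .inl fun x => .inr (Fin.castAdd m x)) fun y => .inr (Fin.natAdd n (f y)))
    have key (v : ι → List A) (xs : Fin n → List A) (ys : Fin m → List A) :
        Sum.elim v (Fin.append xs ys) ∘ (Sum.elim (Sum.elim .inl fun x => .inr (Fin.castAdd m x))
          fun y => .inr (Fin.natAdd n (f y))) = Sum.elim (Sum.elim v xs) (ys ∘ f) := by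
      funext x
      rcases x with (x | x) | x <;> simp
    obtain ⟨⟨φ, hφ, eφ⟩, ⟨ψ, hψ, eψ⟩⟩ := ih hR''
    obtain ⟨φ', hφ', eφ'⟩ := (IsAlternating.exists_block (i := i) m).1 (.of_dual hψ)
    obtain ⟨ψ', hψ', eψ'⟩ := (IsAlternating.exists_block (i := i) m).2 (.of_dual hφ)
    have main (v : ι → List A) (xs : Fin n → List A) : R (Sum.elim v xs) ↔
        ∃ ys : Fin m → List A, ¬ R' (Sum.elim (Sum.elim v xs) (ys ∘ f)) := by
      rw [e]
      constructor
      · rintro ⟨w, hw⟩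
        refine ⟨w ∘ f.symm, ?_⟩
        rwa [Function.comp_assoc, Equiv.symm_comp_self, Function.comp_id]
      · rintro ⟨ys, h⟩
        exact ⟨_, h⟩
    refine ⟨⟨φ', hφ', fun v xs => ?_⟩, ⟨ψ', hψ', fun v xs => ?_⟩⟩
    · rw [eφ', main]
      simp only [eψ, key]
    · rw [eψ', main, not_exists]
      simp only [eφ, key, not_not]

theorem sigmaDefinable_iff_sigDef {k : ℕ} {R : Set (Fin k → List A)} :
    SigmaDefinable i R ↔ SigDef i fun v => v ∈ R := by
  constructor
  · rintro ⟨φ, hφ, e⟩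
    have := (IsAlternating.sigDef hφ).reindex (κ := Fin k) (Sum.elim id Fin.elim0)
    refine SigDef.congr this fun v => ?_
    rw [e]
    exact Eq.to_iff (congrArg (Language.BoundedFormula.Realize φ v) (Subsingleton.elim _ _))
  · intro h
    obtain ⟨φ, hφ, e⟩ := (h.reindex (κ := Fin k ⊕ Fin 0) Sum.inl).exists_formula.1
    refine ⟨φ, hφ, fun v => ?_⟩
    rw [Language.Formula.Realize, e]
    simp

end Hierarchy

/-! ### Existentially definable relations on words -/

section Words

variable {A : Type u}

/-! #### Combinatorics of subwords -/

theorem eq_replicate_of_subset {p : A} {x : List A} (h : ∀ s ∈ x, s = p) :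
    x = List.replicate x.length p :=
  List.eq_replicate_iff.2 ⟨rfl, h⟩

/-- Both sides contain equally many letters `r`, so an embedding uses every `r` on the right and
must send the first `r` to the first `r`. This makes `r` work as a separator, and it is the tool
behind all later comparisons. -/
theorem sublist_append_cons_cancel [DecidableEq A] {r : A} {x x' y y' : List A} (hx : r ∉ x)
    (hy : r ∉ y) (hc : x'.count r = y'.count r) (h : (x ++ r :: x').Sublist (y ++ r :: y')) :
    x.Sublist y ∧ x'.Sublist y' := by
  induction y generalizing x with
  | nil =>
    cases x with
    | nil => exact ⟨List.Sublist.refl _, List.cons_sublist_cons.1 h⟩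
    | cons a x =>
      exfalso
      have ha : a ≠ r := fun e => hx (by simp [e])
      have h' : (a :: x ++ r :: x').Sublist y' := by
        cases h with
        | cons _ h => exact h
        | cons_cons _ h => exact absurd rfl ha
      have := h'.count_le r
      rw [List.count_append, List.count_cons_self] at this
      omega
  | cons b y ih =>
    have hb : b ≠ r := fun e => hy (by simp [e])
    have hy' : r ∉ y := fun e => hy (by simp [e])
    cases x with
    | nil =>
      rw [List.nil_append, List.cons_append] at h
      have h' : (r :: x').Sublist (y ++ r :: y') := by
        cases h with
        | cons _ h => exact h
        | cons_cons _ h => exact absurd rfl hb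
      exact ⟨List.nil_sublist _, (ih (x := []) (by simp) hy' h').2⟩
    | cons a x =>
      have hx' : r ∉ x := fun e => hx (by simp [e])
      rw [List.cons_append, List.cons_append] at h
      cases h with
      | cons _ h =>
        have := ih (x := a :: x) hx hy' h
        exact ⟨this.1.cons _, this.2⟩
      | cons_cons _ h =>
        have := ih hx' hy' h
        exact ⟨this.1.cons_cons _, this.2⟩

theorem List.Sublist.eq_of_count_eq [DecidableEq A] {x y : List A} (h : x.Sublist y)
    (hc : ∀ s, x.count s = y.count s) : x = y :=
  h.eq_of_length (List.perm_iff_count.2 hc).length_eq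

theorem exists_eq_append_cons_of_count_eq_one [DecidableEq A] {r : A} {x : List A}
    (h : x.count r = 1) : ∃ y z, x = y ++ r :: z ∧ r ∉ y ∧ r ∉ z := by
  obtain ⟨y, z, rfl, hy⟩ := List.eq_append_cons_of_mem (List.count_pos_iff.1 (by omega : 0 < x.count r))
  refine ⟨y, z, rfl, hy, ?_⟩
  have hy0 := List.count_eq_zero.2 hy
  rw [← List.count_eq_zero]
  simp at h
  omega

theorem count_eq_one_iff [DecidableEq A] {r : A} {x : List A} :
    x.count r = 1 ↔ [r].Sublist x ∧ ¬ [r, r].Sublist x := by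
  have h₁ := List.replicate_sublist_iff (n := 1) (a := r) (l := x)
  have h₂ := List.replicate_sublist_iff (n := 2) (a := r) (l := x)
  simp only [List.replicate] at h₁ h₂
  rw [h₁, h₂]
  omega

theorem exists_eq_block [DecidableEq A] {p q : A} {W : List A}
    (hW : ∀ s ∈ W, s = p ∨ s = q) (h : W.count q = 1) :
    ∃ m k, W = List.replicate m p ++ q :: List.replicate k p := by
  obtain ⟨y, z, rfl, hy, hz⟩ := exists_eq_append_cons_of_count_eq_one h
  refine ⟨y.length, z.length, ?_⟩
  rw [← eq_replicate_of_subset, ← eq_replicate_of_subset]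
  · intro s hs
    exact (hW s (by simp [hs])).resolve_right fun e => hz (e ▸ hs)
  · intro s hs
    exact (hW s (by simp [hs])).resolve_right fun e => hy (e ▸ hs)

theorem replicate_append_sublist_block [DecidableEq A] {p q : A} (hpq : p ≠ q) {n m k : ℕ} :
    (List.replicate n p ++ [q]).Sublist (List.replicate m p ++ q :: List.replicate k p) ↔
      n ≤ m := by
  have hq : ∀ n, q ∉ List.replicate n p := fun n h => hpq (List.eq_of_mem_replicate h).symm
  constructor
  · intro h
    have := (sublist_append_cons_cancel (hq n) (hq m)
      (by rw [List.count_nil, List.count_eq_zero.2 (hq k)]) h).1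
    simpa using this.length_le
  · intro h
    exact ((List.replicate_sublist_replicate p).2 h).append
      ((List.nil_sublist _).cons_cons q)

theorem cons_replicate_sublist_block [DecidableEq A] {p q : A} (hpq : p ≠ q) {n m k : ℕ} :
    (q :: List.replicate n p).Sublist (List.replicate m p ++ q :: List.replicate k p) ↔
      n ≤ k := by
  rw [← List.reverse_sublist]
  simpa using replicate_append_sublist_block hpq (n := n) (m := k) (k := m)

/-! #### Counting letters -/

variable {ι : Type} {i : ℕ}

theorem SigDef.forall_mem [Finite A] (B : A → Prop) (x : ι) :
    SigDef i fun v : ι → List A => ∀ s ∈ v x, B s := by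
  have : SigDef i fun v : ι → List A => ∀ s : A, B s ∨ ¬ [s].Sublist (v x) :=
    SigDef.forall_finite fun s => (SigDef.prop _).or (SigDef.const_not_sublist _ _)
  refine this.congr fun v => forall_congr' fun s => ?_
  rw [List.singleton_sublist]
  tauto

variable [DecidableEq A] {p q r : A}

theorem SigDef.count_eq_one (r : A) (x : ι) :
    SigDef i fun v : ι → List A => (v x).count r = 1 := by
  simp only [count_eq_one_iff]
  exact (SigDef.const_sublist _ _).and (SigDef.const_not_sublist _ _)

/-- Write W = p^i q p^(d+2), Z = p^j q p^d, y = p^m q. The conditions on `y` say i < m ≤ j, those on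
`x` say j + d < |x| ≤ i + d + 2. Together they leave only m = j = i + 1 and |x| = i + d + 2, so
inequalities alone force an equality of exponents. -/
theorem block_pinch (hpq : p ≠ q) (d : ℕ) (x y : List A) :
    (∃ n, x = List.replicate (n + d + 2) p ∧ y = List.replicate (n + 1) p ++ [q]) ↔
    ∃ W Z, ((∀ s ∈ x, s = p) ∧ (∀ s ∈ y, s = p ∨ s = q) ∧ (∀ s ∈ W, s = p ∨ s = q) ∧
        ∀ s ∈ Z, s = p ∨ s = q) ∧
      (y.count q = 1 ∧ ¬ (q :: List.replicate 1 p).Sublist y) ∧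
      (W.count q = 1 ∧ (q :: List.replicate (d + 2) p).Sublist W ∧
        ¬ (q :: List.replicate (d + 3) p).Sublist W) ∧
      (Z.count q = 1 ∧ (q :: List.replicate d p).Sublist Z ∧
        ¬ (q :: List.replicate (d + 1) p).Sublist Z) ∧
      ¬ x.Sublist Z ∧ y.Sublist Z ∧ ¬ y.Sublist W ∧ x.Sublist W := by
  constructor
  · rintro ⟨n, rfl, rfl⟩
    refine ⟨List.replicate n p ++ q :: List.replicate (d + 2) p,
      List.replicate (n + 1) p ++ q :: List.replicate d p,
      ⟨?_, ?_, ?_, ?_⟩, ⟨?_, ?_⟩, ⟨?_, ?_, ?_⟩, ⟨?_, ?_, ?_⟩, ?_, ?_, ?_, ?_⟩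
    · simp +contextual
    · simp +contextual
    · intro s; simp; tauto
    · intro s; simp; tauto
    · simp [List.count_replicate, hpq]
    · exact (cons_replicate_sublist_block hpq (n := 1) (m := n + 1) (k := 0)).not.2 (by omega)
    · simp [List.count_replicate, hpq]
    · exact (cons_replicate_sublist_block hpq).2 le_rfl
    · exact (cons_replicate_sublist_block hpq).not.2 (by omega)
    · simp [List.count_replicate, hpq]
    · exact (cons_replicate_sublist_block hpq).2 le_rfl
    · exact (cons_replicate_sublist_block hpq).not.2 (by omega)
    · rw [List.replicate_sublist_iff]
      simp [hpq.symm]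
      omega
    · exact (replicate_append_sublist_block hpq).2 le_rfl
    · exact (replicate_append_sublist_block hpq).not.2 (by omega)
    · rw [List.replicate_sublist_iff]
      simp [hpq.symm]
      omega
  · rintro ⟨W, Z, ⟨hx, hy, hW, hZ⟩, ⟨hyq, hyp⟩, ⟨hWq, hWp, hWp'⟩, ⟨hZq, hZp, hZp'⟩,
      h₁, h₂, h₃, h₄⟩
    obtain ⟨m, k, rfl⟩ := exists_eq_block hy hyq
    obtain ⟨m', k', rfl⟩ := exists_eq_block hW hWq
    obtain ⟨m'', k'', rfl⟩ := exists_eq_block hZ hZq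
    rw [cons_replicate_sublist_block hpq] at hyp hWp hWp' hZp hZp'
    obtain rfl : k = 0 := by omega
    rw [eq_replicate_of_subset hx] at h₁ h₄ ⊢
    rw [List.replicate_sublist_iff] at h₁ h₄
    rw [List.replicate_zero, replicate_append_sublist_block hpq] at h₂ h₃
    simp [hpq.symm] at h₁ h₄
    refine ⟨m', ?_, ?_⟩
    · congr 1; omega
    · rw [show m = m' + 1 by omega]; rfl

variable [Finite A]

theorem SigDef.block_pinch (hpq : p ≠ q) (d : ℕ) (x y : ι) : SigDef (i + 1) fun v : ι → List A =>
    ∃ n, v x = List.replicate (n + d + 2) p ∧ v y = List.replicate (n + 1) p ++ [q] := by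
  simp only [_root_.block_pinch hpq]
  exact .ex (.ex (.and
    (.and (.forall_mem _ _) (.and (.forall_mem _ _) (.and (.forall_mem _ _) (.forall_mem _ _))))
    (.and (.and (.count_eq_one _ _) (.const_not_sublist _ _))
    (.and (.and (.count_eq_one _ _) (.and (.const_sublist _ _) (.const_not_sublist _ _)))
    (.and (.and (.count_eq_one _ _) (.and (.const_sublist _ _) (.const_not_sublist _ _)))
    (.and (.not_sublist _ _) (.and (.sublist _ _) (.and (.not_sublist _ _) (.sublist _ _)))))))))

theorem SigDef.succ_power (hpq : p ≠ q) (x y : ι) : SigDef (i + 1) fun v : ι → List A =>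
    ∃ n, v x = List.replicate n p ∧ v y = List.replicate (n + 1) p := by
  -- The common word `z` couples the pinches with offsets 0 and 1, so the two exponents differ by
  -- one. Pinching only reaches exponents from 2 on, so the two smallest cases are listed
  -- separately.
  have h : SigDef (i + 1) fun v : ι → List A => ((v x = [] ∧ v y = [p]) ∨
      (v x = [p] ∧ v y = [p, p])) ∨
      ∃ z, (∃ n, v x = List.replicate (n + 0 + 2) p ∧ z = List.replicate (n + 1) p ++ [q]) ∧
        (∃ n, v y = List.replicate (n + 1 + 2) p ∧ z = List.replicate (n + 1) p ++ [q]) :=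
    .or (.or (.and (.eq_const _ _) (.eq_const _ _)) (.and (.eq_const _ _) (.eq_const _ _)))
      (.ex (.and (.block_pinch hpq 0 _ _) (.block_pinch hpq 1 _ _)))
  refine h.congr fun v => ?_
  constructor
  · rintro ⟨n, h⟩
    match n with
    | 0 => exact .inl (.inl h)
    | 1 => exact .inl (.inr h)
    | n + 2 => exact .inr ⟨_, ⟨n, h.1, rfl⟩, ⟨n, h.2, rfl⟩⟩
  · rintro ((h | h) | ⟨_, ⟨n, hx, rfl⟩, ⟨m, hy, e⟩⟩)
    · exact ⟨0, h⟩
    · exact ⟨1, h⟩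
    · have := congrArg List.length e
      simp at this
      subst this
      exact ⟨_, hx, hy⟩

/-- The count of `p` is the `n` for which p^n embeds and p^(n+1) does not; consecutive powers are
definable, so one `n` can be tested on both words. -/
theorem SigDef.count_eq (hpq : p ≠ q) (x y : ι) : SigDef (i + 1) fun v : ι → List A =>
    (v x).count p = (v y).count p := by
  have h : SigDef (i + 1) fun v : ι → List A => ∃ z z',
      (∃ n, z = List.replicate n p ∧ z' = List.replicate (n + 1) p) ∧
      (z.Sublist (v x) ∧ ¬ z'.Sublist (v x)) ∧ (z.Sublist (v y) ∧ ¬ z'.Sublist (v y)) := by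
    refine .ex (.ex (.and ?_ (.and (.and ?_ ?_) (.and ?_ ?_))))
    · exact SigDef.succ_power hpq (some none) none
    · exact SigDef.sublist (some none) (some (some x))
    · exact SigDef.not_sublist none (some (some x))
    · exact SigDef.sublist (some none) (some (some y))
    · exact SigDef.not_sublist none (some (some y))
  refine h.congr fun v => ?_
  constructor
  · intro h
    refine ⟨_, _, ⟨(v x).count p, rfl, rfl⟩, ?_⟩
    simp only [List.replicate_sublist_iff]
    omega
  · rintro ⟨_, _, ⟨n, rfl, rfl⟩, h⟩
    simp only [List.replicate_sublist_iff] at h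
    omega

theorem SigDef.count_eq_succ (hpq : p ≠ q) (x y : ι) : SigDef (i + 1) fun v : ι → List A =>
    (v y).count p = (v x).count p + 1 := by
  have h : SigDef (i + 1) fun v : ι → List A => ∃ z z',
      (∃ n, z = List.replicate n p ∧ z' = List.replicate (n + 1) p) ∧
      z.count p = (v x).count p ∧ z'.count p = (v y).count p := by
    refine .ex (.ex (.and ?_ (.and ?_ ?_)))
    · exact SigDef.succ_power hpq (some none) none
    · exact SigDef.count_eq hpq (some none) (some (some x))
    · exact SigDef.count_eq hpq none (some (some y))
  refine h.congr fun v => ?_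
  constructor
  · intro h
    exact ⟨_, _, ⟨(v x).count p, rfl, rfl⟩, by simp, by simp [h]⟩
  · rintro ⟨_, _, ⟨n, rfl, rfl⟩, h₁, h₂⟩
    simp at h₁ h₂
    omega

theorem SigDef.eq_replicate_append (hpq : p ≠ q) (x y : ι) : SigDef (i + 1) fun v : ι → List A =>
    v y = List.replicate ((v x).count p) p ++ [q] := by
  have h : SigDef (i + 1) fun v : ι → List A => (∀ s ∈ v y, s = p ∨ s = q) ∧
      (v y).count q = 1 ∧ ¬ [q, p].Sublist (v y) ∧ (v x).count p = (v y).count p :=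
    .and (.forall_mem _ _) (.and (.count_eq_one _ _) (.and (.const_not_sublist _ _)
      (.count_eq hpq _ _)))
  refine h.congr fun v => ?_
  have key (m k) : [q, p].Sublist (List.replicate m p ++ q :: List.replicate k p) ↔ 1 ≤ k :=
    cons_replicate_sublist_block hpq (n := 1) (m := m) (k := k)
  constructor
  · intro h
    rw [h]
    refine ⟨fun s => by simp; tauto, by simp [List.count_replicate, hpq], ?_, ?_⟩
    · have := (key ((v x).count p) 0).not.2 (by omega)
      simpa using this
    · simp [hpq.symm]
  · rintro ⟨h₁, h₂, h₃, h₄⟩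
    obtain ⟨m, k, e⟩ := exists_eq_block h₁ h₂
    rw [e, key] at h₃
    obtain rfl : k = 0 := by omega
    rw [h₄, e]
    simp [hpq.symm]

theorem SigDef.eq_cons_replicate (hpq : p ≠ q) (x y : ι) : SigDef (i + 1) fun v : ι → List A =>
    v y = q :: List.replicate ((v x).count p) p := by
  have h : SigDef (i + 1) fun v : ι → List A => (∀ s ∈ v y, s = p ∨ s = q) ∧
      (v y).count q = 1 ∧ ¬ [p, q].Sublist (v y) ∧ (v x).count p = (v y).count p :=
    .and (.forall_mem _ _) (.and (.count_eq_one _ _) (.and (.const_not_sublist _ _)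
      (.count_eq hpq _ _)))
  refine h.congr fun v => ?_
  have key (m k) : [p, q].Sublist (List.replicate m p ++ q :: List.replicate k p) ↔ 1 ≤ m :=
    replicate_append_sublist_block hpq (n := 1) (m := m) (k := k)
  constructor
  · intro h
    rw [h]
    refine ⟨fun s => by simp; tauto, by simp [List.count_replicate, hpq], ?_, ?_⟩
    · have := (key 0 ((v x).count p)).not.2 (by omega)
      simpa using this
    · simp [hpq.symm]
  · rintro ⟨h₁, h₂, h₃, h₄⟩
    obtain ⟨m, k, e⟩ := exists_eq_block h₁ h₂
    rw [e, key] at h₃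
    obtain rfl : m = 0 := by omega
    rw [h₄, e]
    simp [hpq.symm]

/-- The word W = p^m q p^k has m + k letters `p`. Its two exponents are measured separately: p^n q
embeds iff n ≤ m, and q p^n embeds iff n ≤ k. -/
theorem SigDef.count_add (hpq : p ≠ q) (x y z : ι) : SigDef (i + 1) fun v : ι → List A =>
    (v x).count p + (v y).count p = (v z).count p := by
  have h : SigDef (i + 1) fun v : ι → List A => ∃ x' y' U U' V V' W : List A,
      (x'.count p = (v x).count p + 1 ∧ y'.count p = (v y).count p + 1) ∧
      (U = List.replicate ((v x).count p) p ++ [q] ∧ U' = List.replicate (x'.count p) p ++ [q]) ∧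
      (V = q :: List.replicate ((v y).count p) p ∧ V' = q :: List.replicate (y'.count p) p) ∧
      ((∀ s ∈ W, s = p ∨ s = q) ∧ W.count q = 1) ∧
      (U.Sublist W ∧ ¬ U'.Sublist W) ∧ (V.Sublist W ∧ ¬ V'.Sublist W) ∧
      W.count p = (v z).count p := by
    refine .ex (.ex (.ex (.ex (.ex (.ex (.ex (.and (.and ?_ ?_) (.and (.and ?_ ?_) (.and (.and ?_ ?_)
      (.and (.and (.forall_mem _ _) (.count_eq_one _ _)) (.and (.and ?_ ?_) (.and (.and ?_ ?_)
      ?_))))))))))))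
    · exact SigDef.count_eq_succ hpq _ _
    · exact SigDef.count_eq_succ hpq _ _
    · exact SigDef.eq_replicate_append hpq _ _
    · exact SigDef.eq_replicate_append hpq _ _
    · exact SigDef.eq_cons_replicate hpq _ _
    · exact SigDef.eq_cons_replicate hpq _ _
    · exact SigDef.sublist _ _
    · exact SigDef.not_sublist _ _
    · exact SigDef.sublist _ _
    · exact SigDef.not_sublist _ _
    · exact SigDef.count_eq hpq _ _
  refine h.congr fun v => ?_
  constructor
  · intro h
    refine ⟨List.replicate ((v x).count p + 1) p, List.replicate ((v y).count p + 1) p, _, _, _, _,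
      List.replicate ((v x).count p) p ++ q :: List.replicate ((v y).count p) p,
      ⟨by simp, by simp⟩, ⟨rfl, rfl⟩, ⟨rfl, rfl⟩, ⟨?_, ?_⟩, ?_, ?_, ?_⟩
    · intro s; simp; tauto
    · simp [List.count_replicate, hpq]
    · rw [replicate_append_sublist_block hpq, replicate_append_sublist_block hpq]
      simp
    · rw [cons_replicate_sublist_block hpq, cons_replicate_sublist_block hpq]
      simp
    · simp [hpq.symm, h]
  · rintro ⟨x', y', U, U', V, V', W, ⟨hx', hy'⟩, ⟨rfl, rfl⟩, ⟨rfl, rfl⟩, ⟨h₁, h₂⟩, h₃, h₄, h₅⟩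
    obtain ⟨m, k, rfl⟩ := exists_eq_block h₁ h₂
    rw [replicate_append_sublist_block hpq, replicate_append_sublist_block hpq] at h₃
    rw [cons_replicate_sublist_block hpq, cons_replicate_sublist_block hpq] at h₄
    simp [hpq.symm] at h₅
    omega

end Words

/-! ### Concatenation -/

section Concatenation

variable {A : Type u}

theorem eq_flatten_replicate_of_commute {p q : A} (hpq : p ≠ q) {w : List A}
    (h : [p, q] ++ w = w ++ [p, q]) : ∃ n, w = (List.replicate n [p, q]).flatten := by
  match w with
  | [] => exact ⟨0, rfl⟩
  | [s] =>
    simp at h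
    exact absurd h.2.1.symm hpq
  | s :: t :: w =>
    simp only [List.cons_append, List.nil_append, List.cons.injEq] at h
    obtain ⟨rfl, rfl, h⟩ := h
    obtain ⟨n, rfl⟩ := eq_flatten_replicate_of_commute hpq (w := w) (by simpa using h)
    exact ⟨n + 1, by simp [List.replicate_succ]⟩

theorem commute_flatten_replicate (u : List A) (n : ℕ) :
    u ++ (List.replicate n u).flatten = (List.replicate n u).flatten ++ u := by
  induction n with
  | zero => simp
  | succ n ih => rw [List.replicate_succ, List.flatten_cons, List.append_assoc, ← ih]

variable [DecidableEq A]

/-- The projection of a word to the letters `p` and `q`. -/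
def proj (p q : A) (x : List A) : List A := x.filter fun s => s = p ∨ s = q

theorem mem_proj {p q s : A} {x : List A} : s ∈ proj p q x ↔ s ∈ x ∧ (s = p ∨ s = q) := by
  simp [proj]

theorem proj_append (p q : A) (x y : List A) : proj p q (x ++ y) = proj p q x ++ proj p q y :=
  List.filter_append ..

theorem proj_sublist (p q : A) (x : List A) : (proj p q x).Sublist x := List.filter_sublist

theorem List.Sublist.proj {x y : List A} (h : x.Sublist y) (p q : A) :
    (proj p q x).Sublist (proj p q y) := List.Sublist.filter _ h

theorem proj_cons_left (p q : A) (x : List A) : proj p q (p :: x) = p :: proj p q x := by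
  simp [proj]

theorem proj_cons_right (p q : A) (x : List A) : proj p q (q :: x) = q :: proj p q x := by
  simp [proj]

theorem proj_cons_of_ne {p q s : A} (h₁ : s ≠ p) (h₂ : s ≠ q) (x : List A) :
    proj p q (s :: x) = proj p q x := by
  simp [proj, h₁, h₂]

theorem proj_eq_self {p q : A} {x : List A} (h : ∀ s ∈ x, s = p ∨ s = q) : proj p q x = x := by
  rw [proj, List.filter_eq_self]
  simpa using h

theorem count_proj_left (p q : A) (x : List A) : (proj p q x).count p = x.count p :=
  List.count_filter (by simp)

theorem count_proj_right (p q : A) (x : List A) : (proj p q x).count q = x.count q :=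
  List.count_filter (by simp)

theorem eq_of_count_eq_of_two_letters {p q : A} {x y : List A} (h : x.Sublist y)
    (hy : ∀ s ∈ y, s = p ∨ s = q) (hp : x.count p = y.count p) (hq : x.count q = y.count q) :
    x = y := by
  refine h.eq_of_count_eq fun s => ?_
  by_cases hs : s ∈ y
  · rcases hy s hs with rfl | rfl <;> assumption
  · rw [List.count_eq_zero.2 hs, List.count_eq_zero.2 fun h' => hs (h.subset h')]

/-- A subword that keeps all occurrences of `p` and `q` and no other letter has no freedom left;
only counts and one embedding are needed. -/
theorem eq_proj_iff {p q : A} {x y : List A} :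
    y = proj p q x ↔ (∀ s ∈ y, s = p ∨ s = q) ∧ y.Sublist x ∧ y.count p = x.count p ∧
      y.count q = x.count q := by
  constructor
  · rintro rfl
    exact ⟨fun s hs => (mem_proj.1 hs).2, proj_sublist _ _ _, count_proj_left .., count_proj_right ..⟩
  · rintro ⟨h₁, h₂, h₃, h₄⟩
    have := h₂.proj p q
    rw [proj_eq_self h₁] at this
    refine eq_of_count_eq_of_two_letters this (fun s hs => (mem_proj.1 hs).2) ?_ ?_
    · rw [h₃, count_proj_left]
    · rw [h₄, count_proj_right]

/-- A word over at least two letters is determined by its projections to pairs of letters. -/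
theorem eq_of_proj_eq [Nontrivial A] {x y : List A}
    (h : ∀ p q : A, p ≠ q → proj p q x = proj p q y) : x = y := by
  induction x generalizing y with
  | nil =>
    cases y with
    | nil => rfl
    | cons s y =>
      obtain ⟨t, ht⟩ := exists_ne s
      have := h s t ht.symm
      rw [proj_cons_left] at this
      simp [proj] at this
  | cons s x ih =>
    cases y with
    | nil =>
      obtain ⟨t, ht⟩ := exists_ne s
      have := h s t ht.symm
      rw [proj_cons_left] at this
      simp [proj] at this
    | cons t y =>
      -- If the first letters differed, the projection to exactly these two letters would already
      -- tell the words apart.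
      obtain rfl : s = t := by
        by_contra hst
        have := h s t hst
        rw [proj_cons_left, proj_cons_right] at this
        exact hst (List.cons.inj this).1
      refine congrArg _ (ih fun p q hpq => ?_)
      have := h p q hpq
      by_cases hp : s = p ∨ s = q
      · rcases hp with rfl | rfl
        · rw [proj_cons_left, proj_cons_left] at this
          exact (List.cons.inj this).2
        · rw [proj_cons_right, proj_cons_right] at this
          exact (List.cons.inj this).2
      · rw [not_or] at hp
        rwa [proj_cons_of_ne hp.1 hp.2, proj_cons_of_ne hp.1 hp.2] at this

variable {p q r : A}

theorem eq_append_singleton_iff (hrp : r ≠ p) (hrq : r ≠ q) {x U : List A}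
    (hx : ∀ s ∈ x, s = p ∨ s = q) :
    U = x ++ [r] ↔ (∀ s ∈ U, s = p ∨ s = q ∨ s = r) ∧ U.count r = 1 ∧ ¬ [r, p].Sublist U ∧
      ¬ [r, q].Sublist U ∧ x.Sublist U ∧ x.count p = U.count p ∧ x.count q = U.count q := by
  have hr : r ∉ x := fun h => (hx r h).elim hrp hrq
  constructor
  · rintro rfl
    have key : ∀ s, s ≠ r → ¬ [r, s].Sublist (x ++ [r]) := by
      intro s hs h
      rw [← List.reverse_sublist] at h
      simp only [List.reverse_append, List.reverse_cons, List.reverse_nil, List.nil_append,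
        List.singleton_append] at h
      cases h with
      | cons _ h => exact hr (by simpa using h.subset (List.mem_cons_of_mem _ (List.mem_singleton_self r)))
      | cons_cons _ h => exact hs rfl
    refine ⟨?_, ?_, key p hrp.symm, key q hrq.symm, List.sublist_append_left _ _, ?_, ?_⟩
    · intro s hs
      rw [List.mem_append, List.mem_singleton] at hs
      rcases hs with hs | hs
      · have := hx s hs; tauto
      · tauto
    · simp [List.count_eq_zero.2 hr]
    · simp [hrp]
    · simp [hrq]
  · rintro ⟨h₁, h₂, h₃, h₄, h₅, h₆, h₇⟩
    obtain ⟨y, z, rfl, hy, hz⟩ := exists_eq_append_cons_of_count_eq_one h₂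
    have key : ∀ s, ¬ [r, s].Sublist (y ++ r :: z) → s ∉ z := by
      intro s h hs
      exact h (.trans (List.cons_sublist_cons.2 (List.singleton_sublist.2 hs))
        (List.sublist_append_right _ _))
    obtain rfl : z = [] := by
      refine List.eq_nil_iff_forall_not_mem.2 fun s hs => ?_
      rcases h₁ s (by simp [hs]) with rfl | rfl | rfl
      · exact key _ h₃ hs
      · exact key _ h₄ hs
      · exact hz hs
    have hy' : ∀ s ∈ y, s = p ∨ s = q := by
      intro s hs
      rcases h₁ s (by simp [hs]) with h | h | h
      · exact .inl h
      · exact .inr h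
      · exact absurd (h ▸ hs) hy
    have := h₅.proj p q
    rw [proj_append, proj_eq_self hx, proj_eq_self hy', proj_cons_of_ne hrp hrq] at this
    simp only [proj, List.filter_nil, List.append_nil] at this
    rw [eq_of_count_eq_of_two_letters this hy' (by simpa [hrp] using h₆)
      (by simpa [hrq] using h₇)]

theorem eq_cons_iff (hrp : r ≠ p) (hrq : r ≠ q) {x U : List A}
    (hx : ∀ s ∈ x, s = p ∨ s = q) :
    U = r :: x ↔ (∀ s ∈ U, s = p ∨ s = q ∨ s = r) ∧ U.count r = 1 ∧ ¬ [p, r].Sublist U ∧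
      ¬ [q, r].Sublist U ∧ x.Sublist U ∧ x.count p = U.count p ∧ x.count q = U.count q := by
  have := eq_append_singleton_iff hrp hrq (x := x.reverse) (U := U.reverse) (by simpa using hx)
  rw [← List.reverse_sublist (l₁ := [r, p]), ← List.reverse_sublist (l₁ := [r, q])] at this
  simpa [List.reverse_eq_iff, -List.reverse_sublist, List.reverse_sublist (l₁ := x)] using this

/-- The single `r` in `W` forces `x` to embed to its left and `y` to its right. The counts leave no
room for further letters, so W = x r y, and erasing `r` gives the concatenation. -/
theorem eq_append_iff_of_two_letters (hrp : r ≠ p) (hrq : r ≠ q) {x y z : List A}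
    (hx : ∀ s ∈ x, s = p ∨ s = q) (hy : ∀ s ∈ y, s = p ∨ s = q) :
    z = x ++ y ↔ ∃ U V W, U = x ++ [r] ∧ V = r :: y ∧ (W.count r = 1 ∧
      (∀ s ∈ W, s = p ∨ s = q ∨ s = r)) ∧ (U.Sublist W ∧ V.Sublist W) ∧
      (x.count p + y.count p = W.count p ∧ x.count q + y.count q = W.count q) ∧
      z = proj p q W := by
  have hrx : r ∉ x := fun h => (hx r h).elim hrp hrq
  have hry : r ∉ y := fun h => (hy r h).elim hrp hrq
  constructor
  · rintro rfl
    refine ⟨_, _, x ++ r :: y, rfl, rfl, ⟨?_, ?_⟩, ⟨?_, List.sublist_append_right _ _⟩, ⟨?_, ?_⟩, ?_⟩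
    · simp [List.count_eq_zero.2 hrx, List.count_eq_zero.2 hry]
    · intro s hs
      rw [List.mem_append, List.mem_cons] at hs
      rcases hs with hs | hs | hs
      · have := hx s hs; tauto
      · tauto
      · have := hy s hs; tauto
    · exact (List.Sublist.refl x).append ((List.nil_sublist y).cons_cons r)
    · simp [hrp]
    · simp [hrq]
    · rw [proj_append, proj_cons_of_ne hrp hrq, proj_eq_self hx, proj_eq_self hy]
  · rintro ⟨_, _, W, rfl, rfl, ⟨h₁, h₂⟩, ⟨h₃, h₄⟩, ⟨h₅, h₆⟩, rfl⟩
    obtain ⟨y', z', rfl, hy', hz'⟩ := exists_eq_append_cons_of_count_eq_one h₁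
    have e₁ := (sublist_append_cons_cancel hrx hy'
      (by rw [List.count_nil, List.count_eq_zero.2 hz']) h₃).1
    have e₂ := (sublist_append_cons_cancel (x := []) (by simp) hy'
      (by rw [List.count_eq_zero.2 hry, List.count_eq_zero.2 hz']) h₄).2
    rw [proj_append, proj_cons_of_ne hrp hrq, ← proj_append]
    have hyz : ∀ s ∈ y' ++ z', s = p ∨ s = q := by
      intro s hs
      rw [List.mem_append] at hs
      rcases hs with hs | hs
      · rcases h₂ s (by simp [hs]) with h | h | h
        · exact .inl h
        · exact .inr h
        · exact absurd (h ▸ hs) hy'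
      · rcases h₂ s (by simp [hs]) with h | h | h
        · exact .inl h
        · exact .inr h
        · exact absurd (h ▸ hs) hz'
    rw [proj_eq_self hyz]
    refine (eq_of_count_eq_of_two_letters (e₁.append e₂) hyz ?_ ?_).symm
    · simpa [hrp] using h₅
    · simpa [hrq] using h₆

variable {ι : Type} {i : ℕ} [Finite A]

theorem SigDef.eq_proj (hpq : p ≠ q) (x y : ι) :
    SigDef (i + 1) fun v : ι → List A => v y = proj p q (v x) := by
  simp only [eq_proj_iff]
  exact .and (.forall_mem _ _) (.and (.sublist _ _) (.and (.count_eq hpq _ _)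
    (.count_eq hpq.symm _ _)))

theorem SigDef.eq_append_of_two_letters (hpq : p ≠ q) (hrp : r ≠ p) (hrq : r ≠ q) (x y z : ι) :
    SigDef (i + 1) fun v : ι → List A => ((∀ s ∈ v x, s = p ∨ s = q) ∧
      ∀ s ∈ v y, s = p ∨ s = q) ∧ v z = v x ++ v y := by
  have h : SigDef (i + 1) fun v : ι → List A => ((∀ s ∈ v x, s = p ∨ s = q) ∧
      ∀ s ∈ v y, s = p ∨ s = q) ∧ ∃ U V W : List A,
      ((∀ s ∈ U, s = p ∨ s = q ∨ s = r) ∧ U.count r = 1 ∧ ¬ [r, p].Sublist U ∧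
        ¬ [r, q].Sublist U ∧ (v x).Sublist U ∧ (v x).count p = U.count p ∧
        (v x).count q = U.count q) ∧
      ((∀ s ∈ V, s = p ∨ s = q ∨ s = r) ∧ V.count r = 1 ∧ ¬ [p, r].Sublist V ∧
        ¬ [q, r].Sublist V ∧ (v y).Sublist V ∧ (v y).count p = V.count p ∧
        (v y).count q = V.count q) ∧
      (W.count r = 1 ∧ (∀ s ∈ W, s = p ∨ s = q ∨ s = r)) ∧ (U.Sublist W ∧ V.Sublist W) ∧
      ((v x).count p + (v y).count p = W.count p ∧ (v x).count q + (v y).count q = W.count q) ∧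
      v z = proj p q W :=
    .and (.and (.forall_mem _ _) (.forall_mem _ _)) (.ex (.ex (.ex (.and
      (.and (.forall_mem _ _) (.and (.count_eq_one _ _) (.and (.const_not_sublist _ _) (.and
        (.const_not_sublist _ _) (.and (.sublist _ _) (.and (.count_eq hpq _ _)
        (.count_eq hpq.symm _ _)))))))
      (.and
      (.and (.forall_mem _ _) (.and (.count_eq_one _ _) (.and (.const_not_sublist _ _) (.and
        (.const_not_sublist _ _) (.and (.sublist _ _) (.and (.count_eq hpq _ _)
        (.count_eq hpq.symm _ _)))))))
      (.and (.and (.count_eq_one _ _) (.forall_mem _ _))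
      (.and (.and (.sublist _ _) (.sublist _ _)) (.and (.and (.count_add hpq _ _ _)
        (.count_add hpq.symm _ _ _)) (.eq_proj hpq _ _)))))))))
  refine h.congr fun v => and_congr_right fun hxy => ?_
  rw [eq_append_iff_of_two_letters hrp hrq hxy.1 hxy.2]
  simp only [eq_append_singleton_iff hrp hrq hxy.1, eq_cons_iff hrp hrq hxy.2]

variable (A) in
/-- For every two letters there is a third one. -/
class HasThirdLetter : Prop where
  nontrivial : Nontrivial A
  exists_third : ∀ p q : A, ∃ r, r ≠ p ∧ r ≠ q

theorem SigDef.eq_append [HasThirdLetter A] (x y z : ι) :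
    SigDef (i + 1) fun v : ι → List A => v z = v x ++ v y := by
  have := HasThirdLetter.nontrivial (A := A)
  have h : SigDef (i + 1) fun v : ι → List A => ∀ p q : A, p = q ∨ ∃ X Y Z : List A,
      (X = proj p q (v x) ∧ Y = proj p q (v y) ∧ Z = proj p q (v z)) ∧
      ((∀ s ∈ X, s = p ∨ s = q) ∧ ∀ s ∈ Y, s = p ∨ s = q) ∧ Z = X ++ Y := by
    refine .forall_finite fun p => .forall_finite fun q => ?_
    by_cases hpq : p = q
    · exact SigDef.true.congr fun v => by simp [hpq]
    · obtain ⟨r, hrp, hrq⟩ := HasThirdLetter.exists_third p q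
      exact .or (.prop _) (.ex (.ex (.ex (.and
        (.and (.eq_proj hpq _ _) (.and (.eq_proj hpq _ _) (.eq_proj hpq _ _)))
        (.eq_append_of_two_letters hpq hrp hrq _ _ _)))))
  refine h.congr fun v => ?_
  constructor
  · intro h p q
    refine .inr ⟨_, _, _, ⟨rfl, rfl, rfl⟩, ⟨fun s hs => (mem_proj.1 hs).2,
      fun s hs => (mem_proj.1 hs).2⟩, ?_⟩
    rw [h, proj_append]
  · intro h
    refine eq_of_proj_eq fun p q hpq => ?_
    obtain ⟨_, _, _, ⟨rfl, rfl, rfl⟩, -, e⟩ := (h p q).resolve_left hpq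
    rw [e, proj_append]

/-! #### Powers of a two letter word -/

theorem SigDef.eq_flatten_replicate [HasThirdLetter A] (hpq : p ≠ q) (x : ι) :
    SigDef (i + 1) fun v : ι → List A => ∃ n, v x = (List.replicate n [p, q]).flatten := by
  have h : SigDef (i + 1) fun v : ι → List A => ∃ u w, u = [p, q] ∧ w = u ++ v x ∧ w = v x ++ u :=
    .ex (.ex (.and (.eq_const _ _) (.and (.eq_append _ _ _) (.eq_append _ _ _))))
  refine h.congr fun v => ?_
  constructor
  · rintro ⟨n, h⟩
    refine ⟨_, _, rfl, rfl, ?_⟩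
    rw [h, commute_flatten_replicate]
  · rintro ⟨_, _, rfl, rfl, h⟩
    exact eq_flatten_replicate_of_commute hpq h

/-- A power of pq has as many `p` as `q`, so it transfers a number from one letter to another. -/
theorem SigDef.count_eq_count [HasThirdLetter A] (hpq : p ≠ q) (x y : ι) :
    SigDef (i + 1) fun v : ι → List A => (v x).count p = (v y).count q := by
  have h : SigDef (i + 1) fun v : ι → List A => ∃ w,
      (∃ n, w = (List.replicate n [p, q]).flatten) ∧
      (v x).count p = w.count p ∧ (v y).count q = w.count q :=
    .ex (.and (.eq_flatten_replicate hpq _) (.and (.count_eq hpq _ _) (.count_eq hpq.symm _ _)))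
  refine h.congr fun v => ?_
  have key (n : ℕ) : (List.replicate n [p, q]).flatten.count p = n ∧
      (List.replicate n [p, q]).flatten.count q = n := by
    simp [List.count_flatten, hpq, hpq.symm]
  constructor
  · intro h
    refine ⟨_, ⟨(v x).count p, rfl⟩, ?_⟩
    rw [(key _).1, (key _).2]
    exact ⟨rfl, h.symm⟩
  · rintro ⟨_, ⟨n, rfl⟩, h⟩
    rw [(key _).1, (key _).2] at h
    omega

end Concatenation

/-! ### Vectors of natural numbers as words -/

section Vectors

variable {A : Type u}

/-- The word `a ^ n₁ b a ^ n₂ b ⋯ a ^ nₖ b` that represents the vector `[n₁, …, nₖ]`. -/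
def enc (a b : A) (l : List ℕ) : List A := l.flatMap fun n => List.replicate n a ++ [b]

theorem enc_nil (a b : A) : enc a b [] = [] := rfl

theorem enc_cons (a b : A) (n : ℕ) (l : List ℕ) :
    enc a b (n :: l) = List.replicate n a ++ b :: enc a b l := by
  simp [enc]

theorem enc_append (a b : A) (l l' : List ℕ) : enc a b (l ++ l') = enc a b l ++ enc a b l' := by
  simp [enc]

theorem replicate_append_cons_inj {a b : A} (hab : a ≠ b) {n m : ℕ} {x y : List A}
    (h : List.replicate n a ++ b :: x = List.replicate m a ++ b :: y) : n = m ∧ x = y := by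
  induction n generalizing m with
  | zero =>
    cases m with
    | zero => simpa using h
    | succ m =>
      simp [List.replicate_succ] at h
      exact absurd h.1.symm hab
  | succ n ih =>
    cases m with
    | zero =>
      simp [List.replicate_succ] at h
      exact absurd h.1 hab
    | succ m =>
      simp only [List.replicate_succ, List.cons_append, List.cons.injEq, true_and] at h
      simpa using ih h

theorem enc_injective {a b : A} (hab : a ≠ b) : Function.Injective (enc a b) := by
  intro l
  induction l with
  | nil =>
    intro l' h
    cases l' with
    | nil => rfl
    | cons n l' => simp [enc_cons, enc_nil] at h
  | cons n l ih =>
    intro l' h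
    cases l' with
    | nil => simp [enc_cons, enc_nil] at h
    | cons m l' =>
      rw [enc_cons, enc_cons] at h
      obtain ⟨rfl, h'⟩ := replicate_append_cons_inj hab h
      rw [ih h']

theorem mem_enc {a b s : A} {l : List ℕ} (h : s ∈ enc a b l) : s = a ∨ s = b := by
  simp only [enc, List.mem_flatMap, List.mem_append, List.mem_replicate, List.mem_singleton] at h
  obtain ⟨n, -, h | h⟩ := h
  · exact .inl h.2
  · exact .inr h

theorem exists_eq_enc_append {a b : A} {w : List A} (h : ∀ s ∈ w, s = a ∨ s = b) :
    ∃ l m, w = enc a b l ++ List.replicate m a := by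
  induction w with
  | nil => exact ⟨[], 0, rfl⟩
  | cons s w ih =>
    obtain ⟨l, m, rfl⟩ := ih fun s hs => h s (List.mem_cons_of_mem _ hs)
    rcases h s (List.mem_cons_self ..) with rfl | rfl
    · cases l with
      | nil => exact ⟨[], m + 1, by simp [enc_nil, List.replicate_succ]⟩
      | cons n l => exact ⟨(n + 1) :: l, m, by simp [enc_cons, List.replicate_succ]⟩
    · exact ⟨0 :: l, m, by simp [enc_cons]⟩

theorem exists_eq_enc_iff {a b : A} (hab : a ≠ b) {w : List A} : (∃ l, w = enc a b l) ↔
    (∀ s ∈ w, s = a ∨ s = b) ∧ (w = [] ∨ ∃ u t, t = [b] ∧ w = u ++ t) := by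
  constructor
  · rintro ⟨l, rfl⟩
    refine ⟨fun s hs => mem_enc hs, ?_⟩
    induction l using List.reverseRecOn with
    | nil => exact .inl rfl
    | append_singleton l n _ =>
      refine .inr ⟨enc a b l ++ List.replicate n a, _, rfl, ?_⟩
      simp [enc_append, enc_cons, enc_nil]
  · rintro ⟨h, h'⟩
    obtain ⟨l, m, rfl⟩ := exists_eq_enc_append h
    cases m with
    | zero => exact ⟨l, by simp⟩
    | succ m =>
      exfalso
      rcases h' with h' | ⟨u, _, rfl, h'⟩
      · simp at h'
      · rw [List.replicate_succ', ← List.append_assoc] at h'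
        have := List.append_inj_right' h' rfl
        simp [hab] at this

/-- The words `a ^ x₁ c a ^ y₁ b ⋯ a ^ xₖ c a ^ yₖ b`. -/
def interleave (a b c : A) (l : List (ℕ × ℕ)) : List A :=
  l.flatMap fun z => List.replicate z.1 a ++ c :: (List.replicate z.2 a ++ [b])

theorem interleave_cons (a b c : A) (z : ℕ × ℕ) (l : List (ℕ × ℕ)) :
    interleave a b c (z :: l) = List.replicate z.1 a ++
      c :: (List.replicate z.2 a ++ b :: interleave a b c l) := by
  simp [interleave]

theorem interleave_mono (a b c : A) {β : Type*} {l : List β} {f g : β → ℕ × ℕ}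
    (h : ∀ z ∈ l, (f z).1 ≤ (g z).1 ∧ (f z).2 ≤ (g z).2) :
    (interleave a b c (l.map f)).Sublist (interleave a b c (l.map g)) := by
  induction l with
  | nil => exact List.Sublist.refl _
  | cons z l ih =>
    simp only [List.map_cons, interleave_cons]
    have hz := h z (List.mem_cons_self ..)
    exact ((List.replicate_sublist_replicate a).2 hz.1).append (.cons_cons _
      (((List.replicate_sublist_replicate a).2 hz.2).append (.cons_cons _
      (ih fun z hz => h z (List.mem_cons_of_mem _ hz)))))

variable [DecidableEq A]

theorem count_enc_right {a b : A} (hab : a ≠ b) (l : List ℕ) : (enc a b l).count b = l.length := by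
  induction l with
  | nil => rfl
  | cons n l ih => simp [enc_cons, ih, List.count_replicate, hab]

theorem count_enc_left {a b : A} (hab : a ≠ b) (l : List ℕ) : (enc a b l).count a = l.sum := by
  induction l with
  | nil => rfl
  | cons n l ih => simp [enc_cons, ih, hab.symm]

/-- The morphism that replaces the letter `b` by the word `u`. -/
def replaceLetter (b : A) (u : List A) (w : List A) : List A :=
  w.flatMap fun s => if s = b then u else [s]

theorem replaceLetter_cons_self (b : A) (u w : List A) :
    replaceLetter b u (b :: w) = u ++ replaceLetter b u w := by
  simp [replaceLetter]

theorem replaceLetter_cons_of_ne {b s : A} (h : s ≠ b) (u w : List A) :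
    replaceLetter b u (s :: w) = s :: replaceLetter b u w := by
  simp [replaceLetter, h]

theorem replaceLetter_enc_cons {a b : A} (hab : a ≠ b) (u : List A) (n : ℕ) (l : List ℕ) :
    replaceLetter b u (enc a b (n :: l)) =
      List.replicate n a ++ (u ++ replaceLetter b u (enc a b l)) := by
  rw [enc_cons]
  induction n with
  | zero => exact replaceLetter_cons_self ..
  | succ n ih =>
    rw [List.replicate_succ, List.cons_append, replaceLetter_cons_of_ne hab, ih, List.cons_append]

variable {a b c : A}

/-- If a word `P` in which `b` and `c` alternate, starting with `b`, and a word `Q` in which they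
alternate, starting with `c`, have the same projections to `a, b` and to `a, c`, then each letter
`b` is followed by `c` in `P` and preceded by `c` in `Q`. -/
theorem eq_replaceLetter_of_proj_eq (hab : a ≠ b) (hac : a ≠ c) (hbc : b ≠ c) {P Q : List A}
    {n m : ℕ} (hP : ∀ s ∈ P, s = a ∨ s = b ∨ s = c) (hQ : ∀ s ∈ Q, s = a ∨ s = b ∨ s = c)
    (h₁ : proj a b P = proj a b Q) (h₂ : proj a c P = proj a c Q)
    (h₃ : proj b c P = (List.replicate n [b, c]).flatten)
    (h₄ : proj b c Q = (List.replicate m [c, b]).flatten) :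
    P = replaceLetter b [b, c] (proj a b P) ∧ Q = replaceLetter b [c, b] (proj a b P) := by
  have hPt {s P} (h : ∀ t ∈ s :: P, t = a ∨ t = b ∨ t = c) : ∀ t ∈ P, t = a ∨ t = b ∨ t = c :=
    fun t ht => h t (List.mem_cons_of_mem _ ht)
  have pa (P) := proj_cons_of_ne hab hac P
  have pb (P) := proj_cons_of_ne hab.symm hbc P
  have pc (P) := proj_cons_of_ne hac.symm hbc.symm P
  -- Equal projections mean that the n-th `b` is preceded by equally many `a` in `P` and in `Q`, and
  -- so is the n-th `c`. In `P` the n-th `b` comes before the n-th `c`, in `Q` after it; both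
  -- inequalities together leave no `a` between them. The induction compares leading letters and
  -- removes either an `a` or a pair of `b` and `c` from each word.
  induction hk : P.length using Nat.strong_induction_on generalizing P Q n m with
  | _ k ih =>
  match P, hP with
  | [], _ =>
    have : Q = [] := by
      cases Q with
      | nil => rfl
      | cons t Q =>
        rcases hQ t (List.mem_cons_self ..) with rfl | rfl | rfl
        · simp [proj] at h₁
        · simp [proj] at h₁
        · simp [proj] at h₂
    subst this
    simp [proj, replaceLetter]
  | s :: P, hP =>
    rcases hP s (List.mem_cons_self ..) with rfl | rfl | rfl
    · match Q, hQ with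
      | [], _ => simp [proj] at h₁
      | t :: Q, hQ =>
        rcases hQ t (List.mem_cons_self ..) with rfl | rfl | rfl
        · rw [pa] at h₃ h₄
          rw [proj_cons_left, proj_cons_left] at h₁ h₂
          have := ih P.length (by simp [← hk]) (hPt hP) (hPt hQ)
            (List.cons.inj h₁).2 (List.cons.inj h₂).2 h₃ h₄ rfl
          rw [proj_cons_left, replaceLetter_cons_of_ne hab, replaceLetter_cons_of_ne hab,
            ← this.1, ← this.2]
          exact ⟨rfl, rfl⟩
        · rw [proj_cons_left, proj_cons_right] at h₁
          exact absurd (List.cons.inj h₁).1 hab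
        · rw [proj_cons_left, proj_cons_right] at h₂
          exact absurd (List.cons.inj h₂).1 hac
    · match n with
      | 0 => simp [proj] at h₃
      | n + 1 =>
      rw [List.replicate_succ, List.flatten_cons, proj_cons_left] at h₃
      have h₃' := (List.cons.inj h₃).2
      rw [proj_cons_right] at h₁
      rw [pb] at h₂
      match Q, hQ with
      | [], _ => simp [proj] at h₁
      | t :: Q, hQ =>
        rcases hQ t (List.mem_cons_self ..) with rfl | rfl | rfl
        · rw [proj_cons_left] at h₁
          exact absurd (List.cons.inj h₁).1.symm hab
        · match m with
          | 0 => simp [proj] at h₄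
          | m + 1 =>
            rw [List.replicate_succ, List.flatten_cons, proj_cons_left] at h₄
            exact absurd (List.cons.inj h₄).1 hbc
        · match m with
          | 0 => simp [proj] at h₄
          | m + 1 =>
          rw [List.replicate_succ, List.flatten_cons, proj_cons_right] at h₄
          have h₄' := (List.cons.inj h₄).2
          rw [proj_cons_right] at h₂
          rw [pc] at h₁
          match P, hP with
          | [], _ => simp [proj] at h₂
          | t' :: P, hP =>
            rcases hPt hP t' (List.mem_cons_self ..) with rfl | rfl | rfl
            · rw [proj_cons_left] at h₂
              exact absurd (List.cons.inj h₂).1 hac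
            · rw [proj_cons_left] at h₃'
              exact absurd (List.cons.inj h₃').1 hbc
            · rw [proj_cons_right] at h₃' h₂
              rw [pc] at h₁
              match Q, hQ with
              | [], _ => simp [proj] at h₁
              | t'' :: Q, hQ =>
                rcases hPt hQ t'' (List.mem_cons_self ..) with rfl | rfl | rfl
                · rw [proj_cons_left] at h₁
                  exact absurd (List.cons.inj h₁).1.symm hab
                · rw [proj_cons_left] at h₄'
                  rw [proj_cons_right] at h₁
                  rw [pb] at h₂
                  have := ih P.length (by simp [← hk]) (hPt (hPt hP)) (hPt (hPt hQ))
                    (List.cons.inj h₁).2 (List.cons.inj h₂).2 (List.cons.inj h₃').2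
                    (List.cons.inj h₄').2 rfl
                  rw [proj_cons_right, pc, replaceLetter_cons_self, replaceLetter_cons_self,
                    ← this.1, ← this.2]
                  exact ⟨rfl, rfl⟩
                · rw [proj_cons_right] at h₄'
                  exact absurd (List.cons.inj h₄').1.symm hbc
    · match n with
      | 0 => simp [proj] at h₃
      | n + 1 =>
        rw [List.replicate_succ, List.flatten_cons, proj_cons_right] at h₃
        exact absurd (List.cons.inj h₃).1.symm hbc

theorem proj_replaceLetter (hab : a ≠ b) (hac : a ≠ c) (hbc : b ≠ c) {V : List A}
    (hV : ∀ s ∈ V, s = a ∨ s = b) {u : List A} (hu : u = [b, c] ∨ u = [c, b]) :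
    (∀ s ∈ replaceLetter b u V, s = a ∨ s = b ∨ s = c) ∧
    V = proj a b (replaceLetter b u V) ∧
    proj a c (replaceLetter b u V) = replaceLetter b [c] V ∧
    proj b c (replaceLetter b u V) = (List.replicate (V.count b) u).flatten := by
  have hu₁ : proj a b u = [b] := by
    rcases hu with rfl | rfl <;> simp [proj, hac.symm, hbc.symm]
  have hu₂ : proj a c u = [c] := by
    rcases hu with rfl | rfl <;> simp [proj, hab.symm, hbc]
  have hu₃ : proj b c u = u := by rcases hu with rfl | rfl <;> simp [proj]
  have hu₄ : ∀ s ∈ u, s = a ∨ s = b ∨ s = c := by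
    rcases hu with rfl | rfl <;> intro s <;> simp <;> tauto
  induction V with
  | nil => simp [replaceLetter, proj]
  | cons s V ih =>
    obtain ⟨h₁, h₂, h₃, h₄⟩ := ih fun s hs => hV s (List.mem_cons_of_mem _ hs)
    rcases hV s (List.mem_cons_self ..) with rfl | rfl
    · rw [replaceLetter_cons_of_ne hab, replaceLetter_cons_of_ne hab, proj_cons_left,
        proj_cons_left, proj_cons_of_ne hab hac, ← h₂, h₃, h₄]
      refine ⟨fun s hs => ?_, rfl, rfl, ?_⟩
      · rcases List.mem_cons.1 hs with hs | hs
        · exact .inl hs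
        · exact h₁ s hs
      · rw [List.count_cons_of_ne hab]
    · rw [replaceLetter_cons_self, replaceLetter_cons_self, proj_append, proj_append, proj_append,
        hu₁, hu₂, hu₃, ← h₂, h₃, h₄, List.count_cons_self]
      refine ⟨fun s hs => ?_, rfl, rfl, ?_⟩
      · rcases List.mem_append.1 hs with hs | hs
        · exact hu₄ s hs
        · exact h₁ s hs
      · simp [List.replicate_succ]

theorem count_interleave_left (hab : a ≠ b) (hac : a ≠ c) (l : List (ℕ × ℕ)) :
    (interleave a b c l).count a = (l.map Prod.fst).sum + (l.map Prod.snd).sum := by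
  induction l with
  | nil => rfl
  | cons z l ih =>
    simp [interleave_cons, hab.symm, hac.symm, ih]
    omega

theorem count_interleave_right (hab : a ≠ b) (hbc : b ≠ c) (l : List (ℕ × ℕ)) :
    (interleave a b c l).count b = l.length := by
  induction l with
  | nil => rfl
  | cons z l ih => simp [interleave_cons, List.count_replicate, hab, hbc.symm, ih]

theorem count_interleave_middle (hac : a ≠ c) (hbc : b ≠ c) (l : List (ℕ × ℕ)) :
    (interleave a b c l).count c = l.length := by
  induction l with
  | nil => rfl
  | cons z l ih => simp [interleave_cons, List.count_replicate, hac, hbc, ih]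

/-- All three words have equally many `b` and equally many `c`, so the separators are matched in
order. The first embedding bounds the `a`-blocks before each `c`, the second those before each `b`.
-/
theorem interleave_sublist (hab : a ≠ b) (hac : a ≠ c) (hbc : b ≠ c) {l : List (ℕ × ℕ)}
    {W : List A} (hb : W.count b = l.length) (hc : W.count c = l.length)
    (h₁ : (interleave a b c (l.map fun z => (z.1, 0))).Sublist W)
    (h₂ : (interleave a b c (l.map fun z => (0, z.2))).Sublist W) :
    (interleave a b c l).Sublist W := by
  have ha {n s} (hs : a ≠ s) : s ∉ List.replicate n a :=
    fun h => hs (List.eq_of_mem_replicate h).symm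
  induction l generalizing W with
  | nil => exact List.nil_sublist _
  | cons z l ih =>
    rw [List.length_cons] at hb hc
    obtain ⟨w, W₁, rfl, hw⟩ := List.eq_append_cons_of_mem
      (List.count_pos_iff.1 (by omega : 0 < W.count c))
    simp only [List.map_cons, interleave_cons, List.replicate_zero, List.nil_append] at h₁ h₂
    rw [interleave_cons]
    rw [List.count_append, List.count_cons_self, List.count_eq_zero.2 hw] at hc
    rw [List.count_append, List.count_cons_of_ne hbc.symm] at hb
    have e₁ := sublist_append_cons_cancel (ha hac) hw (by
      rw [List.count_cons_of_ne hbc, count_interleave_middle hac hbc, List.length_map]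
      omega) h₁
    have e₂ := (sublist_append_cons_cancel (x := []) (by simp) hw (by
      rw [List.count_append, List.count_cons_of_ne hbc, count_interleave_middle hac hbc,
        List.count_eq_zero.2 (ha hac), List.length_map]
      omega) h₂).2
    have hb₁ := e₁.2.count_le b
    rw [List.count_cons_self, count_interleave_right hab hbc, List.length_map] at hb₁
    obtain ⟨w', W₂, rfl, hw'⟩ := List.eq_append_cons_of_mem
      (List.count_pos_iff.1 (by omega : 0 < W₁.count b))
    rw [List.count_append, List.count_cons_self, List.count_eq_zero.2 hw'] at hb hb₁
    rw [List.count_append, List.count_cons_of_ne hbc] at hc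
    have e₃ := (sublist_append_cons_cancel (x := []) (by simp) hw' (by
      rw [count_interleave_right hab hbc, List.length_map]
      omega) e₁.2).2
    have e₄ := sublist_append_cons_cancel (ha hab) hw' (by
      rw [count_interleave_right hab hbc, List.length_map]
      omega) e₂
    have hc₁ := e₃.count_le c
    rw [count_interleave_middle hac hbc, List.length_map] at hc₁
    exact e₁.1.append (.cons_cons _ (e₄.1.append (.cons_cons _
      (ih (by omega) (by omega) e₃ e₄.2))))

theorem replaceLetter_enc_eq_interleave (hab : a ≠ b) (l : List (ℕ × ℕ)) :
    replaceLetter b [c, b] (enc a b (l.map Prod.fst)) =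
      interleave a b c (l.map fun z => (z.1, 0)) := by
  induction l with
  | nil => rfl
  | cons z l ih =>
    rw [List.map_cons, replaceLetter_enc_cons hab, ih, List.map_cons, interleave_cons]
    rfl

theorem cons_replaceLetter_enc_eq_interleave (hab : a ≠ b) (l : List (ℕ × ℕ)) :
    c :: replaceLetter b [b, c] (enc a b (l.map Prod.snd)) =
      interleave a b c (l.map fun z => (0, z.2)) ++ [c] := by
  induction l with
  | nil => rfl
  | cons z l ih =>
    rw [List.map_cons, replaceLetter_enc_cons hab, List.map_cons, interleave_cons]
    simp [← ih]

theorem proj_interleave (hac : a ≠ c) (hbc : b ≠ c) (l : List (ℕ × ℕ)) :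
    proj a b (interleave a b c l) = enc a b (l.map fun z => z.1 + z.2) := by
  have ha (n) : proj a b (List.replicate n a) = List.replicate n a :=
    proj_eq_self fun s hs => .inl (List.eq_of_mem_replicate hs)
  induction l with
  | nil => rfl
  | cons z l ih =>
    rw [interleave_cons, List.map_cons, enc_cons, proj_append, ha,
      proj_cons_of_ne hac.symm hbc.symm, proj_append, ha, proj_cons_right, ih,
      ← List.append_assoc, List.replicate_append_replicate]

/-- `W` is forced to be the interleaving: it contains the vectors with one component set to zero,
hence the full interleaving, and the counts exclude anything more. Erasing `c` merges the two blocks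
of each position into their sum. The equation c·Y = Y'·c turns the word with `c` after each `b` into
one with `c` at the start of each entry. -/
theorem enc_add_iff (hab : a ≠ b) (hac : a ≠ c) (hbc : b ≠ c) (l : List (ℕ × ℕ)) (z : List A) :
    z = enc a b (l.map fun z => z.1 + z.2) ↔ ∃ X Y Y' W t t' : List A,
      X = replaceLetter b [c, b] (enc a b (l.map Prod.fst)) ∧
      Y = replaceLetter b [b, c] (enc a b (l.map Prod.snd)) ∧
      (t = [c] ∧ t' = t ++ Y ∧ t' = Y' ++ t) ∧ (X.Sublist W ∧ Y'.Sublist W) ∧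
      (∀ s ∈ W, s = a ∨ s = b ∨ s = c) ∧ (X.count b = W.count b ∧ X.count c = W.count c) ∧
      (enc a b (l.map Prod.fst)).count a + (enc a b (l.map Prod.snd)).count a = W.count a ∧
      z = proj a b W := by
  constructor
  · rintro rfl
    refine ⟨_, _, interleave a b c (l.map fun z : ℕ × ℕ => (0, z.2)), interleave a b c l, _, _, rfl, rfl,
      ⟨rfl, rfl, cons_replaceLetter_enc_eq_interleave hab l⟩, ⟨?_, ?_⟩, ?_, ?_, ?_,
      (proj_interleave hac hbc l).symm⟩
    · rw [replaceLetter_enc_eq_interleave hab]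
      simpa using interleave_mono a b c (l := l) (f := fun z => (z.1, 0)) (g := id) (by simp)
    · simpa using interleave_mono a b c (l := l) (f := fun z => (0, z.2)) (g := id) (by simp)
    · intro s
      simp only [interleave, List.mem_flatMap, List.mem_append, List.mem_cons,
        List.mem_replicate, List.not_mem_nil]
      rintro ⟨_, -, h⟩
      tauto
    · simp [replaceLetter_enc_eq_interleave hab, count_interleave_right hab hbc,
        count_interleave_middle hac hbc]
    · rw [count_enc_left hab, count_enc_left hab, count_interleave_left hab hac]
  · rintro ⟨_, _, Y', W, _, _, rfl, rfl, ⟨rfl, rfl, h₁⟩, ⟨h₂, h₃⟩, h₄, ⟨h₅, h₆⟩, h₇, rfl⟩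
    rw [List.singleton_append, cons_replaceLetter_enc_eq_interleave hab] at h₁
    obtain rfl := (List.append_inj_left' h₁ rfl).symm
    rw [replaceLetter_enc_eq_interleave hab] at h₂ h₅ h₆
    rw [count_interleave_right hab hbc, List.length_map] at h₅
    rw [count_interleave_middle hac hbc, List.length_map] at h₆
    rw [count_enc_left hab, count_enc_left hab] at h₇
    have := interleave_sublist hab hac hbc h₅.symm h₆.symm h₂ h₃
    rw [← proj_interleave hac hbc, this.eq_of_count_eq fun s => ?_]
    by_cases hs : s ∈ W
    · rcases h₄ s hs with rfl | rfl | rfl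
      · rw [count_interleave_left hab hac, h₇]
      · rw [count_interleave_right hab hbc, h₅]
      · rw [count_interleave_middle hac hbc, h₆]
    · rw [List.count_eq_zero.2 hs, List.count_eq_zero.2 fun h' => hs (this.subset h')]

/-! #### Definability -/

variable {ι : Type} {i : ℕ} [Finite A] [HasThirdLetter A]

/-- The two substitutions are defined jointly because each one excludes stray letters `a` between
`b` and `c` in the other. -/
theorem SigDef.eq_replaceLetter (hab : a ≠ b) (hac : a ≠ c) (hbc : b ≠ c) (x y z : ι) :
    SigDef (i + 1) fun v : ι → List A => (∀ s ∈ v x, s = a ∨ s = b) ∧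
      v y = replaceLetter b [b, c] (v x) ∧ v z = replaceLetter b [c, b] (v x) := by
  have h : SigDef (i + 1) fun v : ι → List A => ∃ u w w' : List A,
      ((∀ s ∈ v x, s = a ∨ s = b) ∧ (∀ s ∈ v y, s = a ∨ s = b ∨ s = c) ∧
        ∀ s ∈ v z, s = a ∨ s = b ∨ s = c) ∧
      (v x = proj a b (v y) ∧ v x = proj a b (v z)) ∧ (u = proj a c (v y) ∧ u = proj a c (v z)) ∧
      (w = proj b c (v y) ∧ ∃ n, w = (List.replicate n [b, c]).flatten) ∧
      (w' = proj b c (v z) ∧ ∃ n, w' = (List.replicate n [c, b]).flatten) :=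
    .ex (.ex (.ex (.and
      (.and (.forall_mem _ _) (.and (.forall_mem _ _) (.forall_mem _ _)))
      (.and (.and (.eq_proj hab _ _) (.eq_proj hab _ _))
      (.and (.and (.eq_proj hac _ _) (.eq_proj hac _ _))
      (.and (.and (.eq_proj hbc _ _) (.eq_flatten_replicate hbc _))
      (.and (.eq_proj hbc _ _) (.eq_flatten_replicate hbc.symm _))))))))
  refine h.congr fun v => ?_
  constructor
  · rintro ⟨h₁, h₂, h₃⟩
    rw [h₂, h₃]
    obtain ⟨e₁, e₂, e₃, e₄⟩ := proj_replaceLetter hab hac hbc h₁ (.inl rfl)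
    obtain ⟨d₁, d₂, d₃, d₄⟩ := proj_replaceLetter hab hac hbc h₁ (.inr rfl)
    exact ⟨_, _, _, ⟨h₁, e₁, d₁⟩, ⟨e₂, d₂⟩, ⟨e₃.symm, d₃.symm⟩, ⟨rfl, _, e₄⟩, ⟨rfl, _, d₄⟩⟩
  · rintro ⟨_, _, _, ⟨h₁, h₂, h₃⟩, ⟨h₄, h₅⟩, ⟨rfl, h₆⟩, ⟨rfl, n, h₇⟩, ⟨rfl, m, h₈⟩⟩
    have := eq_replaceLetter_of_proj_eq hab hac hbc h₂ h₃ (h₄.symm.trans h₅) h₆ h₇ h₈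
    rw [← h₄] at this
    exact ⟨h₁, this⟩

theorem SigDef.exists_eq_enc (hab : a ≠ b) (x : ι) :
    SigDef (i + 1) fun v : ι → List A => ∃ l, v x = enc a b l := by
  simp only [exists_eq_enc_iff hab]
  exact .and (.forall_mem _ _) (.or (.eq_const _ _) (.ex (.ex (.and (.eq_const _ _)
    (.eq_append _ _ _)))))

theorem SigDef.enc_add (hab : a ≠ b) (hac : a ≠ c) (hbc : b ≠ c) (x y z : ι) :
    SigDef (i + 1) fun v : ι → List A => ∃ l : List (ℕ × ℕ), v x = enc a b (l.map Prod.fst) ∧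
      v y = enc a b (l.map Prod.snd) ∧ v z = enc a b (l.map fun z => z.1 + z.2) := by
  have h : SigDef (i + 1) fun v : ι → List A => ((∃ l, v x = enc a b l) ∧ (∃ l, v y = enc a b l) ∧
      (v x).count b = (v y).count b) ∧ ∃ X' Y'' X Y Y' W t t' : List A,
      ((∀ s ∈ v x, s = a ∨ s = b) ∧ X' = replaceLetter b [b, c] (v x) ∧
        X = replaceLetter b [c, b] (v x)) ∧
      ((∀ s ∈ v y, s = a ∨ s = b) ∧ Y = replaceLetter b [b, c] (v y) ∧
        Y'' = replaceLetter b [c, b] (v y)) ∧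
      (t = [c] ∧ t' = t ++ Y ∧ t' = Y' ++ t) ∧ (X.Sublist W ∧ Y'.Sublist W) ∧
      (∀ s ∈ W, s = a ∨ s = b ∨ s = c) ∧ (X.count b = W.count b ∧ X.count c = W.count c) ∧
      (v x).count a + (v y).count a = W.count a ∧ v z = proj a b W :=
    .and (.and (.exists_eq_enc hab _) (.and (.exists_eq_enc hab _) (.count_eq hab.symm _ _)))
      (.ex (.ex (.ex (.ex (.ex (.ex (.ex (.ex (.and (.eq_replaceLetter hab hac hbc _ _ _)
      (.and (.eq_replaceLetter hab hac hbc _ _ _)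
      (.and (.and (.eq_const _ _) (.and (.eq_append _ _ _) (.eq_append _ _ _)))
      (.and (.and (.sublist _ _) (.sublist _ _)) (.and (.forall_mem _ _)
      (.and (.and (.count_eq hab.symm _ _) (.count_eq hac.symm _ _))
      (.and (.count_add hab _ _ _) (.eq_proj hab _ _))))))))))))))))
  refine h.congr fun v => ?_
  constructor
  · rintro ⟨l, h₁, h₂, h₃⟩
    obtain ⟨X, Y, Y', W, t, t', e₁, e₂, e⟩ := (enc_add_iff hab hac hbc l _).1 h₃
    rw [← h₁, ← h₂] at e
    refine ⟨⟨⟨_, h₁⟩, ⟨_, h₂⟩, ?_⟩, _, _, X, Y, Y', W, t, t', ⟨?_, rfl, ?_⟩, ⟨?_, ?_, rfl⟩, e⟩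
    · rw [h₁, h₂, count_enc_right hab, count_enc_right hab, List.length_map, List.length_map]
    · rw [h₁]; exact fun s hs => mem_enc hs
    · rw [h₁, e₁]
    · rw [h₂]; exact fun s hs => mem_enc hs
    · rw [h₂, e₂]
  · rintro ⟨⟨⟨l, h₁⟩, ⟨l', h₂⟩, h₃⟩, _, _, X, Y, Y', W, t, t', ⟨-, -, e₁⟩, ⟨-, e₂, -⟩, e⟩
    rw [h₁, h₂, count_enc_right hab, count_enc_right hab] at h₃
    have d₁ : (l.zip l').map Prod.fst = l := List.map_fst_zip h₃.le
    have d₂ : (l.zip l').map Prod.snd = l' := List.map_snd_zip h₃.ge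
    refine ⟨l.zip l', by rw [d₁, h₁], by rw [d₂, h₂], (enc_add_iff hab hac hbc _ _).2 ?_⟩
    rw [d₁, d₂, ← h₁, ← h₂]
    exact ⟨X, Y, Y', W, t, t', e₁, e₂, e⟩

end Vectors

/-! ### Relations between natural numbers that are definable on vectors -/

section VecDef

variable {A : Type u} {ι κ : Type}

/-- The words `w x` represent vectors of the same length such that the numbers in each position
satisfy `R`. -/
def vecRel (a b : A) (R : (ι → ℕ) → Prop) (w : ι → List A) : Prop :=
  ∃ L : List (ι → ℕ), (∀ l ∈ L, R l) ∧ ∀ x, w x = enc a b (L.map fun l => l x)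

/-- The relation `R` between natural numbers, applied in all positions of vectors, is definable
at level `i + 1`. -/
def VecDef (a b : A) (i : ℕ) (R : (ι → ℕ) → Prop) : Prop := SigDef (i + 1) (vecRel a b R)

variable {a b : A} {i : ℕ}

theorem eq_of_map_eval_eq [Nonempty ι] {L L' : List (ι → ℕ)}
    (h : ∀ x, L.map (fun l => l x) = L'.map fun l => l x) : L = L' := by
  obtain ⟨x₀⟩ := ‹Nonempty ι›
  have hl : L.length = L'.length := by simpa using congrArg List.length (h x₀)
  refine List.ext_getElem hl fun n h₁ h₂ => ?_
  funext x
  have := List.getElem_of_eq (h x) (by simpa using h₁ : n < (L.map fun l => l x).length)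
  simpa using this

/-- The words determine the list of tuples, since `enc` is injective. Without variables nothing
would determine its length, hence the nonemptiness assumption. -/
theorem vecRel_iff [Nonempty ι] (hab : a ≠ b) {R : (ι → ℕ) → Prop} {w : ι → List A}
    {L : List (ι → ℕ)} (h : ∀ x, w x = enc a b (L.map fun l => l x)) :
    vecRel a b R w ↔ ∀ l ∈ L, R l := by
  constructor
  · rintro ⟨L', hL', h'⟩
    rwa [eq_of_map_eval_eq fun x => enc_injective hab ((h x).symm.trans (h' x))]
  · exact fun hL => ⟨L, hL, h⟩

theorem vecRel_comp_iff [Nonempty ι] (hab : a ≠ b) {R : (ι → ℕ) → Prop} (f : ι → κ)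
    {w : κ → List A} :
    vecRel a b (fun v => R (v ∘ f)) w ↔ vecRel a b (fun _ => True) w ∧ vecRel a b R (w ∘ f) := by
  have : Nonempty κ := ‹Nonempty ι›.map f
  constructor
  · rintro ⟨L, hL, h⟩
    exact ⟨⟨L, by simp, h⟩, L.map (· ∘ f), by simpa using hL, fun x => by simp [h, Function.comp_def]⟩
  · rintro ⟨⟨L, -, h⟩, h'⟩
    rw [vecRel_iff hab h]
    have := (vecRel_iff hab (L := L.map (· ∘ f)) (w := w ∘ f)
      fun x => by simp [h, Function.comp_def]).1 h'
    simpa using this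

/-- Witnesses chosen separately in each position form one vector of witnesses, so existential
quantification commutes with the pointwise reading. Negation and disjunction do not, which is why
they need arguments of their own. -/
theorem vecRel_exists_iff {P : (ι → ℕ) → (κ → ℕ) → Prop} {w : ι → List A} :
    vecRel a b (fun v => ∃ u, P v u) w ↔ ∃ u : κ → List A, vecRel a b
      (fun v : ι ⊕ κ → ℕ => P (fun x => v (.inl x)) fun y => v (.inr y)) (Sum.elim w u) := by
  constructor
  · rintro ⟨L, hL, h⟩
    choose! g hg using hL
    refine ⟨fun y => enc a b (L.map fun l => g l y), L.map fun l => Sum.elim l (g l), ?_, ?_⟩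
    · simpa using hg
    · rintro (x | y)
      · simp [h, Function.comp_def]
      · simp [Function.comp_def]
  · rintro ⟨u, L, hL, h⟩
    refine ⟨L.map fun l x => l (.inl x), ?_, fun x => ?_⟩
    · simp only [List.mem_map]
      rintro _ ⟨l, hl, rfl⟩
      exact ⟨_, hL l hl⟩
    · simpa [Function.comp_def] using h (.inl x)

theorem VecDef.congr {R S : (ι → ℕ) → Prop} (h : VecDef a b i R) (e : ∀ v, S v ↔ R v) :
    VecDef a b i S := by
  rwa [show S = R from funext fun v => propext (e v)]

theorem VecDef.succ {R : (ι → ℕ) → Prop} (h : VecDef a b i R) : VecDef a b (i + 1) R :=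
  SigDef.succ h

theorem VecDef.and [Nonempty ι] (hab : a ≠ b) {R S : (ι → ℕ) → Prop} (hR : VecDef a b i R)
    (hS : VecDef a b i S) : VecDef a b i fun v => R v ∧ S v := by
  refine (SigDef.and hR hS).congr fun w => ?_
  constructor
  · rintro ⟨L, hL, h⟩
    exact ⟨⟨L, fun l hl => (hL l hl).1, h⟩, ⟨L, fun l hl => (hL l hl).2, h⟩⟩
  · rintro ⟨⟨L, hL, h⟩, h'⟩
    rw [vecRel_iff hab h] at h' ⊢
    exact fun l hl => ⟨hL l hl, h' l hl⟩

theorem VecDef.exists_fun [Finite κ] {P : (ι → ℕ) → (κ → ℕ) → Prop}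
    (h : VecDef a b i fun v : ι ⊕ κ → ℕ => P (fun x => v (.inl x)) fun y => v (.inr y)) :
    VecDef a b i fun v => ∃ u, P v u := by
  refine (SigDef.exists_fun (P := fun w u => vecRel a b (fun v : ι ⊕ κ → ℕ =>
    P (fun x => v (.inl x)) fun y => v (.inr y)) (Sum.elim w u)) ?_).congr
    fun w => vecRel_exists_iff
  refine SigDef.congr h fun w => Eq.to_iff (congrArg _ ?_)
  funext x
  cases x <;> rfl

theorem vecRel_sum_iff {E : (ι → ℕ) → (ι → ℕ) → Prop} {w : ι ⊕ ι → List A} :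
    vecRel a b (fun v : ι ⊕ ι → ℕ => E (fun x => v (.inl x)) fun x => v (.inr x)) w ↔
    ∃ X Y : List (ι → ℕ), List.Forall₂ E X Y ∧
      (∀ x, w (.inl x) = enc a b (X.map fun l => l x)) ∧
      ∀ x, w (.inr x) = enc a b (Y.map fun l => l x) := by
  constructor
  · rintro ⟨L, hL, h⟩
    refine ⟨L.map fun l x => l (.inl x), L.map fun l x => l (.inr x), ?_, ?_, ?_⟩
    · rw [List.forall₂_map_left_iff, List.forall₂_map_right_iff, List.forall₂_same]
      exact hL
    · intro x; simp [h, Function.comp_def]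
    · intro x; simp [h, Function.comp_def]
  · rintro ⟨X, Y, hXY, h₁, h₂⟩
    refine ⟨List.zipWith Sum.elim X Y, ?_, ?_⟩
    · clear h₁ h₂
      induction hXY with
      | nil => simp
      | cons h _ ih => simpa using ⟨h, ih⟩
    · have key : ∀ x, (List.zipWith Sum.elim X Y).map (fun l => l (.inl x)) = X.map (fun l => l x) ∧
          (List.zipWith Sum.elim X Y).map (fun l => l (.inr x)) = Y.map (fun l => l x) := by
        intro x
        clear h₁ h₂
        induction hXY with
        | nil => simp
        | cons h _ ih => simpa using ih
      rintro (x | x)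
      · rw [h₁, (key x).1]
      · rw [h₂, (key x).2]

variable [DecidableEq A]

theorem vecRel_true_iff (hab : a ≠ b) {w : ι → List A} : vecRel a b (fun _ => True) w ↔
    (∀ x, ∃ l, w x = enc a b l) ∧ ∀ x y, (w x).count b = (w y).count b := by
  constructor
  · rintro ⟨L, -, h⟩
    exact ⟨fun x => ⟨_, h x⟩, fun x y => by simp [h, count_enc_right hab]⟩
  · rintro ⟨h, h'⟩
    choose l hl using h
    rcases isEmpty_or_nonempty ι with hι | ⟨⟨x₀⟩⟩
    · exact ⟨[], by simp, fun x => hι.elim x⟩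
    -- All vectors have the length of `l x₀`, so the default 0 is never read.
    · refine ⟨(List.range (l x₀).length).map fun t x => (l x).getD t 0, by simp, fun x => ?_⟩
      have hx := h' x x₀
      rw [hl, hl, count_enc_right hab, count_enc_right hab] at hx
      rw [hl, List.map_map]
      congr 1
      refine List.ext_getElem (by simp [hx]) fun n h₁ h₂ => ?_
      simp [h₁]

variable [Finite A] [HasThirdLetter A]

theorem VecDef.true [Finite ι] (hab : a ≠ b) : VecDef a b i fun _ : ι → ℕ => True := by
  refine SigDef.congr ?_ fun w => vecRel_true_iff hab
  exact .and (.forall_finite fun x => .exists_eq_enc hab x)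
    (.forall_finite fun x => .forall_finite fun y => .count_eq hab.symm x y)

theorem VecDef.reindex [Nonempty ι] [Finite κ] (hab : a ≠ b) {R : (ι → ℕ) → Prop} (f : ι → κ)
    (h : VecDef a b i R) : VecDef a b i fun v : κ → ℕ => R (v ∘ f) :=
  (SigDef.and (VecDef.true hab) (SigDef.reindex f h)).congr fun _ => vecRel_comp_iff hab f

theorem VecDef.ex [Finite ι] {P : (ι → ℕ) → ℕ → Prop} (hab : a ≠ b)
    (h : VecDef a b i fun v : Option ι → ℕ => P (fun x => v (some x)) (v none)) :
    VecDef a b i fun v => ∃ n, P v n := by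
  have := h.reindex (κ := ι ⊕ Unit) hab fun o => o.elim (.inr ()) .inl
  refine (VecDef.exists_fun (κ := Unit) (P := fun v w => P v (w ())) this).congr fun v => ?_
  exact ⟨fun ⟨x, hx⟩ => ⟨fun _ => x, hx⟩, fun ⟨w, hw⟩ => ⟨_, hw⟩⟩

theorem VecDef.forall_finite [Nonempty ι] [Finite ι] (hab : a ≠ b) {β : Type*} [Finite β]
    {P : β → (ι → ℕ) → Prop} (h : ∀ x, VecDef a b i (P x)) : VecDef a b i fun v => ∀ x, P x v := by
  classical
  have := Fintype.ofFinite β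
  have key : ∀ s : Finset β, VecDef a b i fun v => ∀ x ∈ s, P x v := by
    intro s
    induction s using Finset.induction_on with
    | empty => exact (VecDef.true hab).congr fun v => by simp
    | insert x s _ ih => exact ((h x).and hab ih).congr fun v => by simp
  exact (key Finset.univ).congr fun v => by simp

/-! #### Addition and order -/

variable [Finite ι]

theorem VecDef.add (hab : a ≠ b) (x y z : ι) :
    VecDef a b i fun v : ι → ℕ => v x + v y = v z := by
  have : Nonempty ι := ⟨x⟩
  obtain ⟨c, hca, hcb⟩ := HasThirdLetter.exists_third a b
  refine (SigDef.and (VecDef.true hab) (SigDef.enc_add hab hca.symm hcb.symm x y z)).congr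
    fun w => ?_
  constructor
  · rintro ⟨L, hL, h⟩
    refine ⟨⟨L, by simp, h⟩, L.map fun l => (l x, l y), ?_⟩
    simp only [h, List.map_map, Function.comp_def, true_and]
    congr 1
    exact List.map_congr_left fun l hl => (hL l hl).symm
  · rintro ⟨⟨L, -, h⟩, l, h₁, h₂, h₃⟩
    rw [vecRel_iff hab h]
    rw [h] at h₁ h₂ h₃
    replace h₁ := enc_injective hab h₁
    replace h₂ := enc_injective hab h₂
    replace h₃ := enc_injective hab h₃
    obtain rfl : l = L.map fun l => (l x, l y) := by
      refine List.ext_getElem (by simpa using congrArg List.length h₁.symm) fun n d₁ d₂ => ?_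
      have hn : n < L.length := by simpa using d₂
      have e₁ := List.getElem_of_eq h₁ (by simpa using hn)
      have e₂ := List.getElem_of_eq h₂ (by simpa using hn)
      simp at e₁ e₂
      simp [e₁, e₂]
    simp only [List.map_map, Function.comp_def] at h₃
    exact fun l hl => ((List.map_inj_left.1 h₃) l hl).symm

theorem VecDef.eq_zero (hab : a ≠ b) (x : ι) : VecDef a b i fun v : ι → ℕ => v x = 0 := by
  have : Nonempty ι := ⟨x⟩
  refine (VecDef.add hab x x x).congr fun v => ?_
  omega

/-- The vectors with all entries 1 are exactly the powers of the word ab. -/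
theorem VecDef.eq_one (hab : a ≠ b) (x : ι) : VecDef a b i fun v : ι → ℕ => v x = 1 := by
  have : Nonempty ι := ⟨x⟩
  refine (SigDef.and (VecDef.true hab) (SigDef.eq_flatten_replicate hab x)).congr fun w => ?_
  have key (n : ℕ) : (List.replicate n [a, b]).flatten = enc a b (List.replicate n 1) := by
    induction n with
    | zero => rfl
    | succ n ih => simp [List.replicate_succ, ih, enc_cons]
  constructor
  · rintro ⟨L, hL, h⟩
    refine ⟨⟨L, by simp, h⟩, L.length, ?_⟩
    rw [h, key]
    congr 1
    exact List.eq_replicate_iff.2 ⟨by simp, by simpa using hL⟩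
  · rintro ⟨⟨L, -, h⟩, n, h'⟩
    rw [vecRel_iff hab h]
    rw [h, key] at h'
    have := List.eq_replicate_iff.1 (enc_injective hab h')
    simpa using this.2

theorem VecDef.eq (hab : a ≠ b) (x y : ι) : VecDef a b i fun v : ι → ℕ => v x = v y := by
  have : Nonempty ι := ⟨x⟩
  have h : VecDef a b i fun v : ι → ℕ => ∃ n, n = 0 ∧ v x + n = v y :=
    .ex hab (.and hab (.eq_zero hab _) (.add hab _ _ _))
  exact h.congr fun v => by simp

theorem VecDef.le (hab : a ≠ b) (x y : ι) : VecDef a b i fun v : ι → ℕ => v x ≤ v y := by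
  have : Nonempty ι := ⟨x⟩
  have h : VecDef a b i fun v : ι → ℕ => ∃ n, v x + n = v y := .ex hab (.add hab _ _ _)
  exact h.congr fun v => le_iff_exists_add.trans (exists_congr fun _ => eq_comm)

theorem VecDef.eq_succ (hab : a ≠ b) (x y : ι) : VecDef a b i fun v : ι → ℕ => v y = v x + 1 := by
  have : Nonempty ι := ⟨x⟩
  have h : VecDef a b i fun v : ι → ℕ => ∃ n, n = 1 ∧ v x + n = v y :=
    .ex hab (.and hab (.eq_one hab _) (.add hab _ _ _))
  exact h.congr fun v => by simp [eq_comm]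

theorem VecDef.lt (hab : a ≠ b) (x y : ι) : VecDef a b i fun v : ι → ℕ => v x < v y := by
  have : Nonempty ι := ⟨x⟩
  have h : VecDef a b i fun v : ι → ℕ => ∃ n, n = v x + 1 ∧ n ≤ v y :=
    .ex hab (.and hab (.eq_succ hab _ _) (.le hab _ _))
  exact h.congr fun v => ⟨fun h => ⟨_, rfl, h⟩, fun ⟨_, e, h⟩ => by omega⟩

end VecDef

/-! ### Transitive closures -/

section Chains

/-- The chains in different positions may have different lengths. By reflexivity, positions can wait
while another one moves. -/
theorem List.Forall₂.reflTransGen {β : Type*} {E : β → β → Prop} (hE : ∀ s, E s s)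
    {X Y : List β} (h : List.Forall₂ (Relation.ReflTransGen E) X Y) :
    Relation.ReflTransGen (List.Forall₂ E) X Y := by
  have hr (X : List β) : List.Forall₂ E X X := by
    induction X with
    | nil => exact .nil
    | cons s X ih => exact .cons (hE s) ih
  induction h with
  | nil => exact .refl
  | @cons s t X Y h _ ih =>
    exact (h.lift (p := List.Forall₂ E) (· :: X) fun _ _ h => List.Forall₂.cons h (hr X)).trans
      (ih.lift (p := List.Forall₂ E) (t :: ·) fun _ _ h => List.Forall₂.cons (hE t) h)

theorem Relation.ReflTransGen.forall₂ {β : Type*} {E : β → β → Prop} {X Y : List β}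
    (h : Relation.ReflTransGen (List.Forall₂ E) X Y) :
    List.Forall₂ (Relation.ReflTransGen E) X Y := by
  induction h with
  | refl =>
    induction X with
    | nil => exact .nil
    | cons s X ih => exact .cons .refl ih
  | tail _ h ih =>
    clear * - h ih
    induction ih generalizing ‹List β› with
    | nil => cases h; exact .nil
    | cons h' _ ih =>
      cases h with
      | cons h₁ h₂ => exact .cons (h'.tail h₁) (ih h₂)

theorem List.forall₂_append {β γ : Type*} {E : β → γ → Prop} {X X' : List β} {Y Y' : List γ}
    (h : List.Forall₂ E X Y) (h' : List.Forall₂ E X' Y') :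
    List.Forall₂ E (X ++ X') (Y ++ Y') := by
  induction h with
  | nil => exact h'
  | cons h _ ih => exact .cons h ih

/-- A chain of vectors `X = X₀, X₁, …, Xₖ = Y` is represented by the concatenations of
`X₀, …, Xₖ₋₁` and of `X₁, …, Xₖ`. -/
theorem reflTransGen_forall₂_iff {β : Type*} {E : β → β → Prop} {X Y : List β}
    (hXY : X.length = Y.length) : Relation.ReflTransGen (List.Forall₂ E) X Y ↔
    ∃ S S' : List β, X ++ S' = S ++ Y ∧ List.Forall₂ E S S' ∧ X.length ∣ S'.length := by
  constructor
  · intro h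
    clear hXY
    induction h with
    | refl => exact ⟨[], [], by simp, .nil, by simp⟩
    | @tail Y Z h₁ h ih =>
      obtain ⟨S, S', e, hS, hd⟩ := ih
      refine ⟨S ++ Y, S' ++ Z, ?_, List.forall₂_append hS h, ?_⟩
      · rw [← List.append_assoc, e]
      · rw [List.length_append, ← h.length_eq, ← h₁.forall₂.length_eq]
        exact (Nat.dvd_add_self_right).2 hd
  · rintro ⟨S, S', e, hS, k, hk⟩
    induction k generalizing X S S' with
    | zero =>
      obtain rfl : S' = [] := List.eq_nil_of_length_eq_zero (by simpa using hk)
      cases hS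
      rw [List.append_nil, List.nil_append] at e
      rw [e]
    | succ k ih =>
      -- The equation X S' = S Y shows that `S` starts with `X`; the matching initial piece `Z` of
      -- `S'` is one step further, and the rest is a shorter chain from `Z` to `Y`. Divisibility of
      -- the length keeps the pieces aligned with `X`.
      have hS' := hS.length_eq
      obtain ⟨S₁, rfl⟩ : X <+: S := by
        refine List.prefix_of_prefix_length_le (l₃ := S ++ Y) ⟨S', e⟩ ⟨Y, rfl⟩ ?_
        rw [hS', hk]
        exact Nat.le_mul_of_pos_right _ (by omega)
      obtain ⟨Z, S₁', rfl, hZ⟩ : ∃ Z S₁', S' = Z ++ S₁' ∧ Z.length = X.length := by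
        refine ⟨S'.take X.length, S'.drop X.length, (List.take_append_drop _ _).symm, ?_⟩
        rw [List.length_take, ← hS', List.length_append]
        omega
      obtain ⟨h₁, h₂⟩ : List.Forall₂ E X Z ∧ List.Forall₂ E S₁ S₁' := by
        have d₁ := List.forall₂_take X.length hS
        have d₂ := List.forall₂_drop X.length hS
        rw [List.take_left, List.take_left' hZ] at d₁
        rw [List.drop_left, List.drop_left' hZ] at d₂
        exact ⟨d₁, d₂⟩
      rw [List.append_assoc, List.append_cancel_left_eq] at e
      refine .head h₁ (ih (hZ.trans hXY) _ _ e h₂ ?_)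
      rw [List.length_append, Nat.mul_succ] at hk
      rw [hZ]
      omega

end Chains

/-! ### Pointwise definability of reflexive transitive closures -/

section VecDefChains

variable {A : Type u} [DecidableEq A] {a b : A}

/-- The word a b^n is primitive, so only its powers commute with it, and each factor contributes `n`
letters `b`. This makes divisibility of counts expressible by concatenation. -/
theorem dvd_count_of_commute (hab : a ≠ b) {n : ℕ} {D : List A}
    (h : a :: List.replicate n b ++ D = D ++ a :: List.replicate n b) : n ∣ D.count b := by
  induction hk : D.length using Nat.strong_induction_on generalizing D with
  | _ k ih =>
  cases D with
  | nil => simp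
  | cons s D =>
    simp only [List.cons_append, List.cons.injEq] at h
    obtain ⟨rfl, h⟩ := h
    rw [List.count_cons_of_ne hab]
    rcases List.append_eq_append_iff.1 h with ⟨D', rfl, h'⟩ | ⟨D', h', h''⟩
    · rw [List.count_append, List.count_replicate_self]
      refine dvd_add (dvd_refl n) (ih D'.length ?_ h' rfl)
      simp at hk
      omega
    · cases D' with
      | nil =>
        rw [List.append_nil] at h'
        rw [← h', List.count_replicate_self]
      | cons t D' =>
        rw [List.cons_append, List.cons.injEq] at h''
        have : t ∈ List.replicate n b := by rw [h']; simp
        exact absurd (h''.1.trans (List.eq_of_mem_replicate this)) hab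

variable [Finite A] [HasThirdLetter A] {ι : Type} {i : ℕ}

theorem SigDef.count_dvd_count (hab : a ≠ b) (x y : ι) :
    SigDef (i + 1) fun v : ι → List A => (v x).count b ∣ (v y).count b := by
  have h : SigDef (i + 1) fun v : ι → List A => ∃ u t d D w : List A, (∀ s ∈ u, s = b) ∧
      u.count b = (v x).count b ∧ t = [a] ∧ d = t ++ u ∧ w = d ++ D ∧ w = D ++ d ∧
      D.count b = (v y).count b :=
    .ex (.ex (.ex (.ex (.ex (.and (.forall_mem _ _) (.and (.count_eq hab.symm _ _)
      (.and (.eq_const _ _) (.and (.eq_append _ _ _) (.and (.eq_append _ _ _)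
      (.and (.eq_append _ _ _) (.count_eq hab.symm _ _)))))))))))
  refine h.congr fun v => ?_
  constructor
  · rintro ⟨k, hk⟩
    refine ⟨List.replicate ((v x).count b) b, _, _,
      (List.replicate k (a :: List.replicate ((v x).count b) b)).flatten, _, ?_, ?_, rfl, rfl, rfl,
      ?_, ?_⟩
    · exact fun s hs => List.eq_of_mem_replicate hs
    · simp
    · exact commute_flatten_replicate _ _
    · simp [List.count_flatten, hab, hk, mul_comm]
  · rintro ⟨u, _, _, D, _, h₁, h₂, rfl, rfl, rfl, h₃, h₄⟩
    rw [eq_replicate_of_subset h₁] at h₂ h₃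
    rw [List.count_replicate_self] at h₂
    rw [← h₄, ← h₂]
    exact dvd_count_of_commute hab h₃

theorem VecDef.reflTransGen_of_refl [Finite ι] [Nonempty ι] (hab : a ≠ b)
    {E : (ι → ℕ) → (ι → ℕ) → Prop} (hE : ∀ s, E s s)
    (h : VecDef a b i fun v : ι ⊕ ι → ℕ => E (fun x => v (.inl x)) fun x => v (.inr x)) :
    VecDef a b i fun v : ι ⊕ ι → ℕ =>
      Relation.ReflTransGen E (fun x => v (.inl x)) fun x => v (.inr x) := by
  obtain ⟨x₀⟩ := id ‹Nonempty ι›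
  have h' : SigDef (i + 1) fun w : ι ⊕ ι → List A => vecRel a b (fun _ => True) w ∧
      ∃ S : ι ⊕ ι → List A, vecRel a b (fun v => E (fun x => v (.inl x)) fun x => v (.inr x)) S ∧
      (w (.inl x₀)).count b ∣ (S (.inr x₀)).count b ∧
      ∀ x, ∃ u, u = w (.inl x) ++ S (.inr x) ∧ u = S (.inl x) ++ w (.inr x) := by
    refine .and (VecDef.true hab) (.exists_fun (.and ?_ (.and (.count_dvd_count hab _ _)
      (.forall_finite fun x => .ex (.and (.eq_append _ _ _) (.eq_append _ _ _))))))
    exact SigDef.reindex Sum.inr h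
  refine h'.congr fun w => ?_
  constructor
  · intro h
    refine ⟨h.imp fun L hL => ⟨by simp, hL.2⟩, ?_⟩
    obtain ⟨X, Y, hXY, h₁, h₂⟩ := vecRel_sum_iff.1 h
    obtain ⟨S, S', e, hS, hd⟩ :=
      (reflTransGen_forall₂_iff hXY.length_eq).1 (List.Forall₂.reflTransGen hE hXY)
    refine ⟨Sum.elim (fun x => enc a b (S.map fun l => l x))
      (fun x => enc a b (S'.map fun l => l x)), vecRel_sum_iff.2 ⟨S, S', hS, fun _ => rfl,
      fun _ => rfl⟩, ?_, fun x => ⟨_, rfl, ?_⟩⟩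
    · rw [h₁]
      simpa [count_enc_right hab] using hd
    · rw [h₁, h₂, Sum.elim_inl, Sum.elim_inr, ← enc_append, ← enc_append, ← List.map_append,
        ← List.map_append, e]
  · rintro ⟨⟨L, -, hL⟩, T, hT, hd, h⟩
    obtain ⟨S, S', hS, h₁, h₂⟩ := vecRel_sum_iff.1 hT
    obtain ⟨X, Y, hXY, h₃, h₄⟩ := (vecRel_sum_iff (E := fun _ _ => True)).1 ⟨L, by simp, hL⟩
    refine vecRel_sum_iff.2 ⟨X, Y, Relation.ReflTransGen.forall₂ ?_, h₃, h₄⟩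
    refine (reflTransGen_forall₂_iff hXY.length_eq).2 ⟨S, S', ?_, hS, ?_⟩
    · refine eq_of_map_eval_eq fun x => enc_injective hab ?_
      obtain ⟨_, rfl, e⟩ := h x
      rw [List.map_append, List.map_append, enc_append, enc_append, ← h₁, ← h₂, ← h₃, ← h₄, e]
    · rw [h₃, h₂] at hd
      simpa [count_enc_right hab] using hd

end VecDefChains

/-! ### Recursive functions -/

section Recursive

variable {A : Type u} [DecidableEq A] [Finite A] [HasThirdLetter A] {a b : A} {i : ℕ}
variable {ι : Type} [Finite ι]

/-- Steps from s to any t with s ≤ t ≤ 2s never leave 0, but reach arbitrarily large numbers from a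
positive start. This expresses a first conditional without having disjunction. -/
theorem reflTransGen_double_iff {m n : ℕ} : (m = 0 → n = 0) ↔
    ∃ t, Relation.ReflTransGen (fun s t : Unit → ℕ => s () ≤ t () ∧ t () ≤ s () + s ())
      (fun _ => m) (fun _ => t) ∧ n ≤ t := by
  constructor
  · intro h
    by_cases hm : m = 0
    · exact ⟨m, .refl, (h hm).le.trans (Nat.zero_le _)⟩
    · clear h
      induction n with
      | zero => exact ⟨m, .refl, Nat.zero_le _⟩
      | succ n ih =>
        obtain ⟨t, ht, hn⟩ := ih
        -- The witness is 2t, which exceeds t because t stays positive along the chain.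
        refine ⟨t + (t + 1 - 1), ht.tail ⟨?_, ?_⟩, ?_⟩
        · simp
        · simp
        · have : t ≠ 0 := by
            have key : ∀ s : Unit → ℕ, Relation.ReflTransGen
                (fun s t : Unit → ℕ => s () ≤ t () ∧ t () ≤ s () + s ()) (fun _ => m) s →
                s () ≠ 0 := by
              intro s hs
              induction hs with
              | refl => exact hm
              | tail _ h ih => omega
            exact key _ ht
          omega
  · rintro ⟨t, ht, hn⟩ rfl
    have key : ∀ s : Unit → ℕ, Relation.ReflTransGen
        (fun s t : Unit → ℕ => s () ≤ t () ∧ t () ≤ s () + s ()) (fun _ => 0) s → s () = 0 := by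
      intro s hs
      induction hs with
      | refl => rfl
      | tail _ h ih => omega
    have := key _ ht
    omega

theorem VecDef.zero_imp_zero (hab : a ≠ b) (x y : ι) :
    VecDef a b i fun v : ι → ℕ => v x = 0 → v y = 0 := by
  have : Nonempty ι := ⟨x⟩
  have h : VecDef a b i fun v : Unit ⊕ Unit → ℕ => v (.inl ()) ≤ v (.inr ()) ∧
      v (.inr ()) ≤ v (.inl ()) + v (.inl ()) := by
    have h : VecDef a b i fun v : Unit ⊕ Unit → ℕ => v (.inl ()) ≤ v (.inr ()) ∧
        ∃ n, v (.inl ()) + v (.inl ()) = n ∧ v (.inr ()) ≤ n :=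
      .and hab (.le hab _ _) (.ex hab (.and hab (.add hab _ _ _) (.le hab _ _)))
    exact h.congr fun v => by simp
  have h' := VecDef.reflTransGen_of_refl (E := fun s t : Unit → ℕ => s () ≤ t () ∧
    t () ≤ s () + s ()) hab (fun s => by omega) h
  have h'' : VecDef a b i fun v : ι → ℕ => ∃ t,
      Relation.ReflTransGen (fun s t : Unit → ℕ => s () ≤ t () ∧ t () ≤ s () + s ())
        (fun _ => v x) (fun _ => t) ∧ v y ≤ t := by
    refine .ex hab (.and hab ?_ (.le hab _ _))
    exact h'.reindex hab (Sum.elim (fun _ => some x) fun _ => none)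
  exact h''.congr fun v => reflTransGen_double_iff

theorem VecDef.zero_imp_eq (hab : a ≠ b) (x y z : ι) :
    VecDef a b i fun v : ι → ℕ => v x = 0 → v y = v z := by
  have : Nonempty ι := ⟨x⟩
  -- The slacks `d` and `d'` absorb any difference, but must vanish when the guard is 0.
  have h : VecDef a b i fun v : ι → ℕ => ∃ d d' s, (v x = 0 → d = 0) ∧ (v x = 0 → d' = 0) ∧
      v y + d = s ∧ v z + d' = s :=
    .ex hab (.ex hab (.ex hab (.and hab (.zero_imp_zero hab _ _) (.and hab
      (.zero_imp_zero hab _ _) (.and hab (.add hab _ _ _) (.add hab _ _ _))))))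
  refine h.congr fun v => ?_
  constructor
  · intro h
    refine ⟨v z - v y, v y - v z, max (v y) (v z), ?_, ?_, ?_, ?_⟩ <;> omega
  · rintro ⟨d, d', s, h₁, h₂, h₃, h₄⟩ h
    have := h₁ h
    have := h₂ h
    omega

theorem VecDef.or [Nonempty ι] (hab : a ≠ b) {R S : (ι → ℕ) → Prop} (hR : VecDef a b i R)
    (hS : VecDef a b i S) : VecDef a b i fun v => R v ∨ S v := by
  -- In each position m + m' = 1 selects a disjunct, while both `u` and `u'` must still satisfy
  -- theirs. The unselected one is filled with a fixed solution, so unsatisfiable disjuncts are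
  -- treated apart.
  by_cases hR₀ : ∃ v, R v
  swap
  · rw [not_exists] at hR₀
    exact hS.congr fun v => by simp [hR₀]
  by_cases hS₀ : ∃ v, S v
  swap
  · rw [not_exists] at hS₀
    exact hR.congr fun v => by simp [hS₀]
  obtain ⟨r, hr⟩ := hR₀
  obtain ⟨s, hs⟩ := hS₀
  have h : VecDef a b i fun v => ∃ u u' : ι → ℕ, ∃ m m' k, k = 1 ∧ m + m' = k ∧ R u ∧ S u' ∧
      (∀ x, m = 0 → v x = u x) ∧ ∀ x, m' = 0 → v x = u' x := by
    refine .exists_fun (.exists_fun (.ex hab (.ex hab (.ex hab (.and hab (.eq_one hab _)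
      (.and hab (.add hab _ _ _) (.and hab ?_ (.and hab ?_ (.and hab ?_ ?_)))))))))
    · exact hR.reindex hab fun x => some (some (some (Sum.inl (Sum.inr x))))
    · exact hS.reindex hab fun x => some (some (some (Sum.inr x)))
    · exact .forall_finite hab fun x => .zero_imp_eq hab _ _ _
    · exact .forall_finite hab fun x => .zero_imp_eq hab _ _ _
  refine h.congr fun v => ?_
  constructor
  · rintro (h | h)
    · exact ⟨v, s, 0, 1, 1, rfl, rfl, h, hs, by simp, by simp⟩
    · exact ⟨r, v, 1, 0, 1, rfl, rfl, hr, h, by simp, by simp⟩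
  · rintro ⟨u, u', m, m', k, rfl, hm, h₁, h₂, h₃, h₄⟩
    rcases Nat.eq_zero_or_pos m with hm₀ | hm₀
    · obtain rfl : v = u := funext fun x => h₃ x hm₀
      exact .inl h₁
    · obtain rfl : v = u' := funext fun x => h₄ x (by omega)
      exact .inr h₂

theorem VecDef.reflTransGen [Nonempty ι] (hab : a ≠ b) {E : (ι → ℕ) → (ι → ℕ) → Prop}
    (h : VecDef a b i fun v : ι ⊕ ι → ℕ => E (fun x => v (.inl x)) fun x => v (.inr x)) :
    VecDef a b i fun v : ι ⊕ ι → ℕ =>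
      Relation.ReflTransGen E (fun x => v (.inl x)) fun x => v (.inr x) := by
  rw [← Relation.reflTransGen_reflGen]
  refine VecDef.reflTransGen_of_refl hab (fun s => .refl) ?_
  refine (VecDef.or hab h (VecDef.forall_finite hab fun x : ι =>
    VecDef.eq hab (Sum.inr x) (Sum.inl x))).congr fun v => ?_
  rw [Relation.reflGen_iff, or_comm]
  exact or_congr_right funext_iff

/-- The transitive closure of a relation between triples of numbers. -/
theorem VecDef.reflTransGen_triple (hab : a ≠ b) {E : ℕ × ℕ × ℕ → ℕ × ℕ × ℕ → Prop}
    (h : ∀ {κ : Type} [Finite κ] (x y z x' y' z' : κ),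
      VecDef a b i fun v : κ → ℕ => E (v x, v y, v z) (v x', v y', v z'))
    (x y z x' y' z' : ι) : VecDef a b i fun v : ι → ℕ =>
      Relation.ReflTransGen E (v x, v y, v z) (v x', v y', v z') := by
  have h' := VecDef.reflTransGen hab (E := fun s t : Fin 3 → ℕ => E (s 0, s 1, s 2) (t 0, t 1, t 2))
    (h (κ := Fin 3 ⊕ Fin 3) (.inl 0) (.inl 1) (.inl 2) (.inr 0) (.inr 1) (.inr 2))
  refine (h'.reindex hab (Sum.elim ![x, y, z] ![x', y', z'])).congr fun v => ?_
  constructor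
  · intro h
    have := h.lift (p := fun s t : Fin 3 → ℕ => E (s 0, s 1, s 2) (t 0, t 1, t 2))
      (fun s : ℕ × ℕ × ℕ => (![s.1, s.2.1, s.2.2] : Fin 3 → ℕ)) fun _ _ h => h
    convert this using 1
    · funext x; fin_cases x <;> rfl
    · funext x; fin_cases x <;> rfl
  · intro h
    exact h.lift (p := E) (fun s : Fin 3 → ℕ => (s 0, s 1, s 2)) fun _ _ h => h

/-! #### Arithmetic -/

theorem reflTransGen_add_iff {m n z : ℕ} : Relation.ReflTransGen
    (fun s t : ℕ × ℕ × ℕ => t.1 = s.1 + 1 ∧ s.2.1 + s.2.2 = t.2.1 ∧ t.2.2 = s.2.2)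
    (0, 0, n) (m, z, n) ↔ m * n = z := by
  constructor
  · intro h
    have key : ∀ s : ℕ × ℕ × ℕ, Relation.ReflTransGen
        (fun s t : ℕ × ℕ × ℕ => t.1 = s.1 + 1 ∧ s.2.1 + s.2.2 = t.2.1 ∧ t.2.2 = s.2.2)
        (0, 0, n) s → s.1 * n = s.2.1 ∧ s.2.2 = n := by
      intro s hs
      induction hs with
      | refl => simp
      | tail _ h ih =>
        rw [h.1, ← h.2.1, h.2.2, ih.2, ← ih.1]
        exact ⟨by ring, rfl⟩
    exact (key _ h).1
  · rintro rfl
    induction m with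
    | zero => simpa using Relation.ReflTransGen.refl
    | succ m ih => exact ih.tail ⟨rfl, by ring, rfl⟩

theorem VecDef.mul (hab : a ≠ b) (x y z : ι) :
    VecDef a b i fun v : ι → ℕ => v x * v y = v z := by
  have : Nonempty ι := ⟨x⟩
  have h : VecDef a b i fun v : ι → ℕ => ∃ n, n = 0 ∧ Relation.ReflTransGen
      (fun s t : ℕ × ℕ × ℕ => t.1 = s.1 + 1 ∧ s.2.1 + s.2.2 = t.2.1 ∧ t.2.2 = s.2.2)
      (n, n, v y) (v x, v z, v y) := by
    refine .ex hab (.and hab (.eq_zero hab _) ?_)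
    refine VecDef.reflTransGen_triple hab (fun x y z x' y' z' => ?_) _ _ _ _ _ _
    have : Nonempty _ := ⟨x⟩
    exact .and hab (.eq_succ hab _ _) (.and hab (.add hab _ _ _) (.eq hab _ _))
  exact h.congr fun v => by simp [reflTransGen_add_iff]

theorem VecDef.eq_pair (hab : a ≠ b) (x y z : ι) :
    VecDef a b i fun v : ι → ℕ => v z = Nat.pair (v x) (v y) := by
  have : Nonempty ι := ⟨x⟩
  have h : VecDef a b i fun v : ι → ℕ =>
      (v x < v y ∧ ∃ s, v y * v y = s ∧ s + v x = v z) ∨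
      (v y ≤ v x ∧ ∃ s t, v x * v x = s ∧ s + v x = t ∧ t + v y = v z) :=
    .or hab (.and hab (.lt hab _ _) (.ex hab (.and hab (.mul hab _ _ _) (.add hab _ _ _))))
      (.and hab (.le hab _ _) (.ex hab (.ex hab (.and hab (.mul hab _ _ _)
        (.and hab (.add hab _ _ _) (.add hab _ _ _))))))
  refine h.congr fun v => ?_
  rw [Nat.pair]
  split_ifs with hxy
  · simp [hxy, hxy.not_ge, eq_comm]
  · simp [hxy, not_lt.1 hxy, eq_comm]

/-! #### Partial functions -/

/-- The graph of the partial function `f` is definable on vectors. -/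
def GraphDef (a b : A) (i : ℕ) (f : ℕ →. ℕ) : Prop :=
  ∀ ⦃κ : Type⦄ [Finite κ] (x y : κ), VecDef a b i fun v : κ → ℕ => v y ∈ f (v x)

theorem GraphDef.pair (hab : a ≠ b) {f g : ℕ →. ℕ} (hf : GraphDef a b i f)
    (hg : GraphDef a b i g) : GraphDef a b i fun n => Nat.pair <$> f n <*> g n := by
  intro κ _ x y
  have : Nonempty κ := ⟨x⟩
  have h : VecDef a b i fun v : κ → ℕ => ∃ m n, m ∈ f (v x) ∧ n ∈ g (v x) ∧ v y = Nat.pair m n :=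
    .ex hab (.ex hab (.and hab (hf _ _) (.and hab (hg _ _) (.eq_pair hab _ _ _))))
  refine h.congr fun v => ?_
  simp only [Seq.seq, Part.map_eq_map, Part.mem_bind_iff, Part.mem_map_iff]
  constructor
  · rintro ⟨_, ⟨m, hm, rfl⟩, n, hn, e⟩
    exact ⟨m, n, hm, hn, e.symm⟩
  · rintro ⟨m, n, hm, hn, e⟩
    exact ⟨_, ⟨m, hm, rfl⟩, n, hn, e.symm⟩

theorem GraphDef.comp (hab : a ≠ b) {f g : ℕ →. ℕ} (hf : GraphDef a b i f)
    (hg : GraphDef a b i g) : GraphDef a b i fun n => g n >>= f := by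
  intro κ _ x y
  have : Nonempty κ := ⟨x⟩
  have h : VecDef a b i fun v : κ → ℕ => ∃ m, m ∈ g (v x) ∧ v y ∈ f m :=
    .ex hab (.and hab (hg _ _) (hf _ _))
  exact h.congr fun v => Part.mem_bind_iff

/-- A state holds the parameter, the counter and the current value, so recursion becomes
reachability between triples. -/
theorem mem_rec_iff (f g : ℕ →. ℕ) (m n r : ℕ) :
    r ∈ Nat.rec (motive := fun _ => Part ℕ) (f m)
      (fun y IH => IH >>= fun i => g (Nat.pair m (Nat.pair y i))) n ↔
    ∃ s ∈ f m, Relation.ReflTransGen (fun s t : ℕ × ℕ × ℕ => t.1 = s.1 ∧ t.2.1 = s.2.1 + 1 ∧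
      t.2.2 ∈ g (Nat.pair s.1 (Nat.pair s.2.1 s.2.2))) (m, 0, s) (m, n, r) := by
  constructor
  · intro h
    induction n generalizing r with
    | zero => exact ⟨r, h, .refl⟩
    | succ n ih =>
      obtain ⟨r', hr', h⟩ := Part.mem_bind_iff.1 h
      obtain ⟨s, hs, hs'⟩ := ih r' hr'
      exact ⟨s, hs, hs'.tail ⟨rfl, rfl, h⟩⟩
  · rintro ⟨s, hs, h⟩
    have key : ∀ t : ℕ × ℕ × ℕ, Relation.ReflTransGen (fun s t : ℕ × ℕ × ℕ => t.1 = s.1 ∧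
        t.2.1 = s.2.1 + 1 ∧ t.2.2 ∈ g (Nat.pair s.1 (Nat.pair s.2.1 s.2.2))) (m, 0, s) t →
        t.1 = m ∧ t.2.2 ∈ Nat.rec (motive := fun _ => Part ℕ) (f m)
          (fun y IH => IH >>= fun i => g (Nat.pair m (Nat.pair y i))) t.2.1 := by
      intro t ht
      induction ht with
      | refl => exact ⟨rfl, hs⟩
      | tail _ h ih =>
        refine ⟨h.1.trans ih.1, ?_⟩
        rw [h.2.1]
        refine Part.mem_bind_iff.2 ⟨_, ih.2, ?_⟩
        rw [← ih.1]
        exact h.2.2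
    exact (key _ h).2

theorem GraphDef.prec (hab : a ≠ b) {f g : ℕ →. ℕ} (hf : GraphDef a b i f)
    (hg : GraphDef a b i g) : GraphDef a b i fun p => Nat.rec (motive := fun _ => Part ℕ)
      (f p.unpair.1) (fun y IH => IH >>= fun i => g (Nat.pair p.unpair.1 (Nat.pair y i)))
      p.unpair.2 := by
  intro κ _ x y
  have : Nonempty κ := ⟨x⟩
  have h : VecDef a b i fun v : κ → ℕ => ∃ m n s z, v x = Nat.pair m n ∧ s ∈ f m ∧ z = 0 ∧
      Relation.ReflTransGen (fun s t : ℕ × ℕ × ℕ => t.1 = s.1 ∧ t.2.1 = s.2.1 + 1 ∧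
        t.2.2 ∈ g (Nat.pair s.1 (Nat.pair s.2.1 s.2.2))) (m, z, s) (m, n, v y) := by
    refine .ex hab (.ex hab (.ex hab (.ex hab (.and hab (.eq_pair hab _ _ _) (.and hab (hf _ _)
      (.and hab (.eq_zero hab _) ?_))))))
    refine VecDef.reflTransGen_triple hab (fun {κ} _ x y z x' y' z' => ?_) _ _ _ _ _ _
    have : Nonempty κ := ⟨x⟩
    have h : VecDef a b i fun v : κ → ℕ => v x' = v x ∧ v y' = v y + 1 ∧ ∃ p q,
        p = Nat.pair (v y) (v z) ∧ q = Nat.pair (v x) p ∧ v z' ∈ g q :=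
      .and hab (.eq hab _ _) (.and hab (.eq_succ hab _ _) (.ex hab (.ex hab (.and hab
        (.eq_pair hab _ _ _) (.and hab (.eq_pair hab _ _ _) (hg _ _))))))
    exact h.congr fun v => by simp
  refine h.congr fun v => ?_
  refine (mem_rec_iff f g (Nat.unpair (v x)).1 (Nat.unpair (v x)).2 (v y)).trans ?_
  constructor
  · rintro ⟨s, hs, h⟩
    exact ⟨_, _, s, 0, (Nat.pair_unpair _).symm, hs, rfl, h⟩
  · rintro ⟨m, n, s, _, e, hs, rfl, h⟩
    rw [e, Nat.unpair_pair]
    exact ⟨s, hs, h⟩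

/-- The chain certifies that `f` is defined and positive at all arguments below `n`. The third
component records the last positive value; the second kind of step resets it to 0, so that the
endpoints of the chain are fixed. -/
theorem mem_rfind_iff (f : ℕ →. ℕ) (m n : ℕ) :
    n ∈ Nat.rfind (fun n => (fun m => decide (m = 0)) <$> f (Nat.pair m n)) ↔
    0 ∈ f (Nat.pair m n) ∧ Relation.ReflTransGen (fun s t : ℕ × ℕ × ℕ => t.1 = s.1 ∧
      t.2.1 = s.2.1 + 1 ∧ 0 < t.2.2 ∧ t.2.2 ∈ f (Nat.pair s.1 s.2.1) ∨
      t.1 = s.1 ∧ t.2.1 = s.2.1 ∧ t.2.2 = 0)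
      (m, 0, 0) (m, n, 0) := by
  refine Nat.mem_rfind.trans ?_
  simp only [Part.map_eq_map, Part.mem_map_iff, decide_eq_true_eq, exists_eq_right,
    decide_eq_false_iff_not]
  refine and_congr_right fun _ => ?_
  constructor
  · intro h
    have key : ∀ k ≤ n, Relation.ReflTransGen (fun s t : ℕ × ℕ × ℕ => t.1 = s.1 ∧
        t.2.1 = s.2.1 + 1 ∧ 0 < t.2.2 ∧ t.2.2 ∈ f (Nat.pair s.1 s.2.1) ∨
        t.1 = s.1 ∧ t.2.1 = s.2.1 ∧ t.2.2 = 0)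
        (m, 0, 0) (m, k, 0) := by
      intro k hk
      induction k with
      | zero => exact .refl
      | succ k ih =>
        obtain ⟨s, hs, hs'⟩ := h (m := k) (by omega)
        exact ((ih (by omega)).tail (b := (m, k, 0)) (c := (m, k + 1, s))
          (.inl ⟨rfl, rfl, Nat.pos_of_ne_zero hs', hs⟩)).tail (.inr ⟨rfl, rfl, rfl⟩)
    exact key n le_rfl
  · intro h
    have key : ∀ t : ℕ × ℕ × ℕ, Relation.ReflTransGen (fun s t : ℕ × ℕ × ℕ => t.1 = s.1 ∧
        t.2.1 = s.2.1 + 1 ∧ 0 < t.2.2 ∧ t.2.2 ∈ f (Nat.pair s.1 s.2.1) ∨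
        t.1 = s.1 ∧ t.2.1 = s.2.1 ∧ t.2.2 = 0) (m, 0, 0) t →
        t.1 = m ∧ ∀ k < t.2.1, ∃ s ∈ f (Nat.pair m k), s ≠ 0 := by
      intro t ht
      induction ht with
      | refl => exact ⟨rfl, by simp⟩
      | tail _ h ih =>
        rcases h with h | h
        · refine ⟨h.1.trans ih.1, fun k hk => ?_⟩
          rw [h.2.1] at hk
          rcases Nat.lt_succ_iff_lt_or_eq.1 hk with hk | rfl
          · exact ih.2 k hk
          · rw [← ih.1]
            exact ⟨_, h.2.2.2, h.2.2.1.ne'⟩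
        · rw [h.1, h.2.1]
          exact ih
    intro k hk
    obtain ⟨s, hs, hs'⟩ := (key _ h).2 k hk
    exact ⟨s, hs, hs'⟩

theorem GraphDef.rfind (hab : a ≠ b) {f : ℕ →. ℕ} (hf : GraphDef a b i f) :
    GraphDef a b i fun m =>
      Nat.rfind fun n => (fun m => decide (m = 0)) <$> f (Nat.pair m n) := by
  intro κ _ x y
  have : Nonempty κ := ⟨x⟩
  have h : VecDef a b i fun v : κ → ℕ => ∃ p z, p = Nat.pair (v x) (v y) ∧ z = 0 ∧ z ∈ f p ∧
      Relation.ReflTransGen (fun s t : ℕ × ℕ × ℕ => t.1 = s.1 ∧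
        t.2.1 = s.2.1 + 1 ∧ 0 < t.2.2 ∧ t.2.2 ∈ f (Nat.pair s.1 s.2.1) ∨
        t.1 = s.1 ∧ t.2.1 = s.2.1 ∧ t.2.2 = 0) (v x, z, z) (v x, v y, z) := by
    refine .ex hab (.ex hab (.and hab (.eq_pair hab _ _ _) (.and hab (.eq_zero hab _) (.and hab
      (hf _ _) ?_))))
    refine VecDef.reflTransGen_triple hab (fun {κ} _ x y z x' y' z' => ?_) _ _ _ _ _ _
    have : Nonempty κ := ⟨x⟩
    have h : VecDef a b i fun v : κ → ℕ => (v x' = v x ∧ v y' = v y + 1 ∧ (∃ z, z = 0 ∧ z < v z') ∧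
        ∃ p, p = Nat.pair (v x) (v y) ∧ v z' ∈ f p) ∨ v x' = v x ∧ v y' = v y ∧ v z' = 0 :=
      .or hab (.and hab (.eq hab _ _) (.and hab (.eq_succ hab _ _) (.and hab
        (.ex hab (.and hab (.eq_zero hab _) (.lt hab _ _)))
        (.ex hab (.and hab (.eq_pair hab _ _ _) (hf _ _))))))
        (.and hab (.eq hab _ _) (.and hab (.eq hab _ _) (.eq_zero hab _)))
    exact h.congr fun v => by simp
  refine h.congr fun v => ?_
  refine (mem_rfind_iff f (v x) (v y)).trans ?_
  simp

theorem GraphDef.of_recursiveIn (hab : a ≠ b) {O : Set (ℕ →. ℕ)}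
    (hO : ∀ g ∈ O, GraphDef a b i g) {f : ℕ →. ℕ} (hf : Nat.RecursiveIn O f) :
    GraphDef a b i f := by
  induction hf with
  | zero =>
    intro κ _ x y
    exact (VecDef.eq_zero hab y).congr fun v => Part.mem_some_iff
  | succ =>
    intro κ _ x y
    exact (VecDef.eq_succ hab x y).congr fun v => Part.mem_some_iff
  | left =>
    intro κ _ x y
    have h : VecDef a b i fun v : κ → ℕ => ∃ n, v x = Nat.pair (v y) n :=
      .ex hab (.eq_pair hab _ _ _)
    refine h.congr fun v => Part.mem_some_iff.trans ?_
    constructor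
    · intro h
      exact ⟨(v x).unpair.2, by rw [h, Nat.pair_unpair]⟩
    · rintro ⟨n, h⟩
      rw [h, Nat.unpair_pair]
  | right =>
    intro κ _ x y
    have h : VecDef a b i fun v : κ → ℕ => ∃ n, v x = Nat.pair n (v y) :=
      .ex hab (.eq_pair hab _ _ _)
    refine h.congr fun v => Part.mem_some_iff.trans ?_
    constructor
    · intro h
      exact ⟨(v x).unpair.1, by rw [h, Nat.pair_unpair]⟩
    · rintro ⟨n, h⟩
      rw [h, Nat.unpair_pair]
  | oracle g hg => exact hO g hg
  | pair _ _ ihf ihg => exact .pair hab ihf ihg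
  | comp _ _ ihf ihg => exact .comp hab ihf ihg
  | prec _ _ ihf ihg => exact .prec hab ihf ihg
  | rfind _ ihf => exact .rfind hab ihf

/-! #### The arithmetical hierarchy -/

theorem VecDef.mem_of_recursiveIn (hab : a ≠ b) {O : Set (ℕ →. ℕ)}
    (hO : ∀ g ∈ O, GraphDef a b i g) {S : Set ℕ}
    (hS : RecursiveIn O fun n => Part.assert (n ∈ S) fun _ => Part.some ()) (x : ι) :
    VecDef a b i fun v : ι → ℕ => v x ∈ S := by
  have : Nonempty ι := ⟨x⟩
  have h : VecDef a b i fun v : ι → ℕ => ∃ n, n ∈ Part.bind (Encodable.decode (α := ℕ) (v x))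
      fun m => (Part.assert (m ∈ S) fun _ => Part.some ()).map Encodable.encode :=
    .ex hab (GraphDef.of_recursiveIn hab hO hS _ _)
  refine h.congr fun v => ?_
  simp

/-- Having some entry in `S` is existential: the vector splits as u t t' where `t` is a vector with
a single entry, and that entry lies in `S`. Its negation speaks about all positions at once, as the
pointwise reading requires, and costs one level. -/
theorem VecDef.not_mem (hab : a ≠ b) {S : Set ℕ}
    (hS : VecDef a b i fun v : Unit → ℕ => v () ∈ S) (x : ι) :
    VecDef a b (i + 1) fun v : ι → ℕ => v x ∉ S := by
  have : Nonempty ι := ⟨x⟩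
  have h : SigDef (i + 1) fun w : ι → List A => ∃ u t t' y : List A,
      ((∃ l, u = enc a b l) ∧ (∃ l, t' = enc a b l)) ∧
      vecRel a b (fun v : Unit → ℕ => v () ∈ S) (fun _ => t) ∧ t.count b = 1 ∧
      y = u ++ t ∧ w x = y ++ t' := by
    refine .ex (.ex (.ex (.ex (.and (.and (.exists_eq_enc hab _) (.exists_eq_enc hab _))
      (.and ?_ (.and (.count_eq_one _ _) (.and (.eq_append _ _ _) (.eq_append _ _ _))))))))
    exact SigDef.reindex (fun _ : Unit => (some (some none) : Option (Option (Option (Option ι))))) hS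
  refine (SigDef.and (VecDef.true hab) (SigDef.not h)).congr fun w => ?_
  constructor
  · rintro ⟨L, hL, h⟩
    refine ⟨⟨L, by simp, h⟩, ?_⟩
    rintro ⟨_, _, _, _, ⟨⟨l, rfl⟩, ⟨l', rfl⟩⟩, ⟨T, hT, ht⟩, h₁, rfl, h₂⟩
    replace ht := ht ()
    subst ht
    rw [count_enc_right hab, List.length_map, List.length_eq_one_iff] at h₁
    obtain ⟨n, rfl⟩ := h₁
    rw [h, ← enc_append, ← enc_append] at h₂
    have h₃ := enc_injective hab h₂
    have : n () ∈ L.map fun l => l x := by rw [h₃]; simp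
    obtain ⟨l, hl, e⟩ := List.mem_map.1 this
    exact hL l hl (e ▸ hT n (by simp))
  · rintro ⟨⟨L, -, h⟩, h'⟩
    refine ⟨L, fun l hl hx => h' ?_, h⟩
    obtain ⟨L₁, L₂, rfl⟩ := List.append_of_mem hl
    refine ⟨_, enc a b [l x], _, _, ⟨⟨L₁.map fun l => l x, rfl⟩, ⟨L₂.map fun l => l x, rfl⟩⟩,
      ⟨[fun _ => l x], by simpa using hx, fun _ => rfl⟩, ?_, rfl, ?_⟩
    · rw [count_enc_right hab]; rfl
    · rw [h, ← enc_append, ← enc_append]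
      simp

theorem VecDef.mem_of_arithmeticalSigma (hab : a ≠ b) {S : Set ℕ}
    (hS : ArithmeticalSigma (i + 1) S) (x : ι) : VecDef a b i fun v : ι → ℕ => v x ∈ S := by
  induction i generalizing S ι with
  | zero =>
    exact VecDef.mem_of_recursiveIn (O := ∅) hab (by simp) (Partrec.recursiveIn hS) x
  | succ i ih =>
    obtain ⟨T, hT, hS⟩ := hS
    refine VecDef.mem_of_recursiveIn hab ?_ hS x
    rintro _ rfl κ _ x y
    have : Nonempty κ := ⟨x⟩
    -- The oracle's graph uses both `T` and its complement; the complement is what requires the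
    -- higher level.
    have h : VecDef a b (i + 1) fun v : κ → ℕ => (v x ∈ T ∧ v y = 1) ∨ (v x ∉ T ∧ v y = 0) :=
      .or hab (.and hab (ih hT _).succ (.eq_one hab _)) (.and hab (.not_mem hab (ih hT _) _)
        (.eq_zero hab _))
    refine h.congr fun v => ?_
    by_cases hx : v x ∈ T <;> simp [membershipOracle, hx]

end Recursive

/-! ### Relations in the arithmetical hierarchy are definable -/

section WordCode

/-- The fold step of an injective coding of vectors by numbers. -/
def pairSucc (D n : ℕ) : ℕ := Nat.pair D n + 1

/-- The successor in `pairSucc` separates nonempty lists from the empty one, coded by 0; then the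
last entry and the code of the rest are read off the pair. -/
theorem foldl_pairSucc_injective : Function.Injective fun l : List ℕ => l.foldl pairSucc 0 := by
  intro l
  induction l using List.reverseRecOn with
  | nil =>
    intro l' h
    cases l' using List.reverseRecOn with
    | nil => rfl
    | append_singleton l' n => simp [pairSucc] at h
  | append_singleton l n ih =>
    intro l' h
    cases l' using List.reverseRecOn with
    | nil => simp [pairSucc] at h
    | append_singleton l' m =>
      simp only [List.foldl_append, List.foldl_cons, List.foldl_nil, pairSucc,
        Nat.add_right_cancel_iff, Nat.pair_eq_pair] at h
      rw [ih h.1, h.2]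

/-- The computation of a fold, as a list of triples of a value, an entry and the next value. -/
theorem foldl_eq_iff_exists (g : ℕ → ℕ → ℕ) (l : List ℕ) (D m : ℕ) :
    l.foldl g D = m ↔ ∃ L : List (Fin 3 → ℕ), (∀ s ∈ L, s 2 = g (s 0) (s 1)) ∧
      L.map (fun s => s 1) = l ∧ D :: L.map (fun s => s 2) = L.map (fun s => s 0) ++ [m] := by
  induction l generalizing D with
  | nil =>
    constructor
    · rintro rfl
      exact ⟨[], by simp⟩
    · rintro ⟨L, -, h, h'⟩
      rw [List.map_eq_nil_iff] at h
      subst h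
      simpa using h'
  | cons n l ih =>
    rw [List.foldl_cons, ih]
    constructor
    · rintro ⟨L, h₁, h₂, h₃⟩
      refine ⟨![D, n, g D n] :: L, by simpa using h₁, by simp [h₂], ?_⟩
      simp only [List.map_cons, List.cons_append, ← h₃]
      rfl
    · rintro ⟨L, h₁, h₂, h₃⟩
      cases L with
      | nil => simp at h₂
      | cons s L =>
        simp only [List.map_cons, List.cons.injEq, List.cons_append] at h₂ h₃
        refine ⟨L, fun s hs => h₁ s (by simp [hs]), h₂.2, ?_⟩
        rw [← h₃.2, h₁ s (by simp), h₂.1, ← h₃.1]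

/-- The object with a given code, or a default value. -/
def decodeD (α : Type*) [Primcodable α] [Inhabited α] (n : ℕ) : α :=
  (Encodable.decode n).getD default

theorem decodeD_encode {α : Type*} [Primcodable α] [Inhabited α] (x : α) :
    decodeD α (Encodable.encode x) = x := by
  simp [decodeD]

theorem primrec_decodeD (α : Type*) [Primcodable α] [Inhabited α] : Primrec (decodeD α) :=
  Primrec.option_getD.comp Primrec.decode (Primrec.const default)

variable {A : Type u} [DecidableEq A] {p q : A}

/-- One step of the computation of `wordCode`. -/
def wordCodeStep (p q : A) (D : ℕ × ℕ) (s : A) : ℕ × ℕ :=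
  if s = p then (D.1, D.2 + 1) else if s = q then (pairSucc D.1 D.2, 0) else D

/-- A number that codes the projection of a word to the letters `p` and `q`. -/
def wordCode (p q : A) (x : List A) : ℕ := ((x ++ [q]).foldl (wordCodeStep p q) (0, 0)).1

theorem foldl_wordCodeStep_proj (x : List A) (D : ℕ × ℕ) :
    (proj p q x).foldl (wordCodeStep p q) D = x.foldl (wordCodeStep p q) D := by
  induction x generalizing D with
  | nil => rfl
  | cons s x ih =>
    by_cases hp : s = p
    · subst hp
      simp [proj_cons_left, ih]
    by_cases hq : s = q
    · subst hq
      simp [proj_cons_right, ih]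
    simp [proj_cons_of_ne hp hq, ih, wordCodeStep, hp, hq]

theorem foldl_wordCodeStep_enc (hpq : p ≠ q) (l : List ℕ) (D : ℕ) :
    (enc p q l).foldl (wordCodeStep p q) (D, 0) = (l.foldl pairSucc D, 0) := by
  have h (n : ℕ) (D : ℕ × ℕ) :
      (List.replicate n p).foldl (wordCodeStep p q) D = (D.1, D.2 + n) := by
    induction n generalizing D with
    | zero => rfl
    | succ n ih => simp [List.replicate_succ, ih, wordCodeStep]; omega
  induction l generalizing D with
  | nil => rfl
  | cons n l ih => simp [enc_cons, h, wordCodeStep, hpq.symm, ih]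

theorem wordCode_eq (hpq : p ≠ q) {x : List A} {l : List ℕ} (h : proj p q x ++ [q] = enc p q l) :
    wordCode p q x = l.foldl pairSucc 0 := by
  rw [wordCode, List.foldl_append, ← foldl_wordCodeStep_proj x, ← List.foldl_append, h,
    foldl_wordCodeStep_enc hpq]

/-- The extra final `q` closes the last block of letters `p`, so every two-letter word becomes a
vector and its trailing `p`s are not lost. -/
theorem exists_proj_append_eq_enc (hpq : p ≠ q) (x : List A) :
    ∃ l, proj p q x ++ [q] = enc p q l := by
  rw [exists_eq_enc_iff hpq]
  refine ⟨fun s hs => ?_, .inr ⟨_, _, rfl, rfl⟩⟩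
  rw [List.mem_append, List.mem_singleton] at hs
  rcases hs with hs | rfl
  · exact (mem_proj.1 hs).2
  · exact .inr rfl

theorem proj_eq_of_wordCode_eq (hpq : p ≠ q) {x y : List A}
    (h : wordCode p q x = wordCode p q y) : proj p q x = proj p q y := by
  obtain ⟨l, hl⟩ := exists_proj_append_eq_enc hpq x
  obtain ⟨l', hl'⟩ := exists_proj_append_eq_enc hpq y
  rw [wordCode_eq hpq hl, wordCode_eq hpq hl'] at h
  rw [← foldl_pairSucc_injective h, ← hl] at hl'
  exact (List.append_cancel_right hl').symm

theorem primrec_wordCode [Primcodable A] (p q : A) : Primrec (wordCode p q) := by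
  have h : Primrec₂ fun (_ : List A) (z : (ℕ × ℕ) × A) => wordCodeStep p q z.1 z.2 := by
    have h₁ : Primrec fun z : List A × (ℕ × ℕ) × A => z.2.1.1 :=
      Primrec.fst.comp (Primrec.fst.comp Primrec.snd)
    have h₂ : Primrec fun z : List A × (ℕ × ℕ) × A => z.2.1.2 :=
      Primrec.snd.comp (Primrec.fst.comp Primrec.snd)
    have h₃ : Primrec fun z : List A × (ℕ × ℕ) × A => z.2.2 := Primrec.snd.comp Primrec.snd
    have h₄ : Primrec fun z : List A × (ℕ × ℕ) × A => pairSucc z.2.1.1 z.2.1.2 :=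
      Primrec.succ.comp (Primrec₂.natPair.comp h₁ h₂)
    exact Primrec.ite (Primrec.eq.comp h₃ (Primrec.const p))
      (Primrec.pair h₁ (Primrec.succ.comp h₂))
      (Primrec.ite (Primrec.eq.comp h₃ (Primrec.const q)) (Primrec.pair h₄ (Primrec.const 0))
        (Primrec.fst.comp Primrec.snd))
  exact Primrec.fst.comp (Primrec.list_foldl
    (Primrec.list_append.comp Primrec.id (Primrec.const [q])) (Primrec.const (0, 0)) h)

variable {a b : A}

theorem exists_eq_enc_singleton (hab : a ≠ b) {z : List A} (h : ∃ l, z = enc a b l)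
    (h' : z.count b = 1) : ∃ n, z = enc a b [n] := by
  obtain ⟨l, rfl⟩ := h
  rw [count_enc_right hab, List.length_eq_one_iff] at h'
  obtain ⟨n, rfl⟩ := h'
  exact ⟨n, rfl⟩

variable [Finite A] [HasThirdLetter A] {ι : Type} {i : ℕ}

theorem VecDef.eq_pairSucc [Finite ι] (hab : a ≠ b) (x y z : ι) :
    VecDef a b i fun v : ι → ℕ => v z = pairSucc (v x) (v y) := by
  have : Nonempty ι := ⟨x⟩
  have h : VecDef a b i fun v : ι → ℕ => ∃ n, n = Nat.pair (v x) (v y) ∧ v z = n + 1 :=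
    .ex hab (.and hab (.eq_pair hab _ _ _) (.eq_succ hab _ _))
  refine h.congr fun v => ?_
  simp [pairSucc]

theorem SigDef.eq_enc_wordCode (hpq : p ≠ q) (x z : ι) :
    SigDef (i + 1) fun v : ι → List A => v z = enc p q [wordCode p q (v x)] := by
  -- The vectors `C₀` and `C₁` list the values before and after each step of the fold along `y'`.
  -- The two factorisations of `C` say that the first value is 0, each result is the next input, and
  -- the last result is the entry of `v z`. Here `t` = [q] also serves as the vector with single
  -- entry 0.
  have h : SigDef (i + 1) fun v : ι → List A => ∃ y t y' C C₀ C₁ : List A,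
      (y = proj p q (v x) ∧ t = [q] ∧ y' = y ++ t) ∧
      vecRel p q (fun s : Fin 3 → ℕ => s 2 = pairSucc (s 0) (s 1)) ![C₀, y', C₁] ∧
      (C = t ++ C₁ ∧ C = C₀ ++ v z) ∧ (∃ l, v z = enc p q l) ∧ (v z).count q = 1 := by
    refine .ex (.ex (.ex (.ex (.ex (.ex (.and
      (.and (.eq_proj hpq _ _) (.and (.eq_const _ _) (.eq_append _ _ _)))
      (.and ?_ (.and (.and (.eq_append _ _ _) (.eq_append _ _ _))
        (.and (.exists_eq_enc hpq _) (.count_eq_one _ _))))))))))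
    refine SigDef.congr (SigDef.reindex
      (![some none, some (some (some none)), none] :
        Fin 3 → Option (Option (Option (Option (Option (Option ι))))))
      (VecDef.eq_pairSucc (i := i) hpq (0 : Fin 3) 1 2)) fun v => ?_
    refine iff_of_eq (congrArg _ ?_)
    funext j
    fin_cases j <;> rfl
  refine h.congr fun v => ?_
  obtain ⟨l, hl⟩ := exists_proj_append_eq_enc hpq (v x)
  rw [wordCode_eq hpq hl]
  have h₀ : [q] = enc p q [0] := rfl
  constructor
  · intro hz
    obtain ⟨L, h₁, h₂, h₃⟩ := (foldl_eq_iff_exists pairSucc l 0 _).1 rfl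
    refine ⟨_, _, _, _, enc p q (L.map fun s => s 0), enc p q (L.map fun s => s 2),
      ⟨rfl, rfl, rfl⟩, ⟨L, h₁, fun j => ?_⟩, ⟨rfl, ?_⟩, ⟨_, hz⟩, ?_⟩
    · fin_cases j
      · rfl
      · exact hl.trans (congrArg _ h₂.symm)
      · rfl
    · rw [hz, h₀, ← enc_append, ← enc_append, ← h₃]
      rfl
    · rw [hz, count_enc_right hpq]
      rfl
  · rintro ⟨_, _, _, _, C₀, C₁, ⟨rfl, rfl, rfl⟩, ⟨L, h₁, h₂⟩, ⟨rfl, h₃⟩, h₄, h₅⟩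
    obtain ⟨m, hm⟩ := exists_eq_enc_singleton hpq h₄ h₅
    obtain rfl : C₀ = _ := h₂ 0
    obtain rfl : C₁ = _ := h₂ 2
    have h₆ : proj p q (v x) ++ [q] = enc p q (L.map fun s => s 1) := h₂ 1
    rw [hl] at h₆
    rw [hm, h₀, ← enc_append, ← enc_append] at h₃
    rw [hm, (foldl_eq_iff_exists pairSucc l 0 m).2
      ⟨L, h₁, (enc_injective hpq h₆).symm, enc_injective hpq h₃⟩]

theorem SigDef.of_inSigmaZero [Primcodable A] {k : ℕ} {R : Set (Fin k → List A)}
    (hR : InSigmaZero (i + 1) R) : SigDef (i + 1) fun v => v ∈ R := by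
  obtain ⟨a, b, hab⟩ := (HasThirdLetter.nontrivial : Nontrivial A).exists_pair_ne
  have : Nontrivial A := ⟨a, b, hab⟩
  let F (j : Fin k) (p q : A) (n : ℕ) : ℕ := wordCode p q (decodeD (Fin k → List A) n j)
  have hF (j p q) : Nat.Partrec fun n => Part.some (F j p q n) := by
    have : Primrec (F j p q) := (primrec_wordCode p q).comp
      (Primrec.fin_app.comp (primrec_decodeD _) (Primrec.const j))
    exact Nat.Partrec.of_primrec (Primrec.nat_iff.1 this)
  have hG (j p q) (hpq : p ≠ q) :
      SigDef (i + 1) (vecRel p q fun s : Fin 2 → ℕ => s 1 = F j p q (s 0)) := by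
    have h : VecDef p q i fun s : Fin 2 → ℕ => s 1 ∈ Part.some (F j p q (s 0)) :=
      GraphDef.of_recursiveIn (O := ∅) hpq (by simp) (Nat.Partrec.recursiveIn (hF j p q)) _ _
    exact h.congr fun v => by simp
  obtain ⟨S, hS, hSR⟩ : ∃ S, ArithmeticalSigma (i + 1) S ∧ ∀ n, n ∈ S ↔ ∃ u ∈ R,
      @Encodable.encode _ Primcodable.toEncodable u = n := ⟨_, hR, fun _ => Iff.rfl⟩
  -- A code is guessed as a one-entry vector `e`. For each component and each pair of letters it is
  -- copied to `e'` over these letters, and the code of the projection computed from the number must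
  -- agree with the one computed from the word.
  have h : SigDef (i + 1) fun v : Fin k → List A => ∃ e : List A,
      (vecRel a b (fun s : Unit → ℕ => s () ∈ S) (fun _ => e) ∧ e.count b = 1) ∧
        ∀ (j : Fin k) (p q : A), p = q ∨ ∃ e' z : List A,
          z = enc p q [wordCode p q (v j)] ∧
          vecRel p q (fun s : Fin 2 → ℕ => s 1 = F j p q (s 0)) ![e', z] ∧
          e.count a = e'.count p := by
    refine .ex (.and (.and ?_ (.count_eq_one _ _))
      (.forall_finite fun j => .forall_finite fun p => .forall_finite fun q => ?_))
    · exact SigDef.reindex (fun _ : Unit => (none : Option (Fin k)))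
        (VecDef.mem_of_arithmeticalSigma hab hS ())
    · by_cases hpq : p = q
      · exact SigDef.true.congr fun v => by simp [hpq]
      refine .or (.prop _) (.ex (.ex (.and (.eq_enc_wordCode hpq _ _) (.and ?_ ?_))))
      · refine SigDef.congr (SigDef.reindex
          (![some none, none] : Fin 2 → Option (Option (Option (Fin k)))) (hG j p q hpq))
          fun v => ?_
        refine iff_of_eq (congrArg _ ?_)
        funext j
        fin_cases j <;> rfl
      · by_cases hap : a = p
        · subst hap
          exact .count_eq hab _ _
        · exact .count_eq_count hap _ _
  refine h.congr fun v => ?_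
  constructor
  · intro hv
    refine ⟨enc a b [@Encodable.encode _ Primcodable.toEncodable v],
      ⟨⟨[fun _ => _], by simpa [hSR] using hv, fun _ => rfl⟩, ?_⟩, fun j p q => ?_⟩
    · rw [count_enc_right hab]
      rfl
    refine or_iff_not_imp_left.2 fun hpq =>
      ⟨enc p q [@Encodable.encode _ Primcodable.toEncodable v], _, rfl, ⟨[![@Encodable.encode _ Primcodable.toEncodable v, wordCode p q (v j)] ], ?_,
        fun j => ?_⟩, ?_⟩
    · simp [F, decodeD_encode]
    · fin_cases j <;> rfl
    · rw [count_enc_left hab, count_enc_left hpq]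
  · rintro ⟨e, ⟨⟨L, hL, he⟩, hb⟩, hj⟩
    obtain rfl : e = _ := he ()
    rw [count_enc_right hab, List.length_map, List.length_eq_one_iff] at hb
    obtain ⟨n, rfl⟩ := hb
    obtain ⟨u, hu, hn⟩ := (hSR _).1 (hL n (by simp))
    suffices u = v from this ▸ hu
    -- The guessed number codes a tuple `u` in `R`; agreement of all projection codes identifies `u`
    -- with `v`.
    refine funext fun j => eq_of_proj_eq fun p q hpq => proj_eq_of_wordCode_eq hpq ?_
    obtain ⟨e', _, rfl, ⟨M, hM, h⟩, hc⟩ := (hj j p q).resolve_left hpq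
    have h₀ : e' = enc p q _ := h 0
    have h₁ : [wordCode p q (v j)] = M.map fun s => s 1 := enc_injective hpq (h 1)
    obtain ⟨s, rfl⟩ := List.length_eq_one_iff.1 (by simpa using (congrArg List.length h₁).symm)
    simp only [List.map_cons, List.map_nil, List.cons.injEq, and_true] at h₁ h₀
    rw [h₀, count_enc_left hab, count_enc_left hpq] at hc
    have hc' : n () = s 0 := by simpa using hc
    rw [h₁, hM s (by simp), ← hc', ← hn]
    simp only [F, decodeD_encode]

end WordCode

/-! ### Definable relations belong to the arithmetical hierarchy -/

section Definable

/-- The oracle is total, so minimisation searches for the first `m` at which it answers 0 and halts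
iff there is one. -/
theorem REIn.exists_not_mem (T : Set ℕ) : REIn T {n | ∃ m, Nat.pair n m ∉ T} := by
  have h : Nat.RecursiveIn {membershipOracle T} fun n =>
      (Nat.rfind fun m => (fun k => decide (k = 0)) <$> membershipOracle T (Nat.pair n m)) >>=
        fun _ => (0 : Part ℕ) :=
    .comp .zero (.rfind (.oracle _ rfl))
  refine h.of_eq fun n => ?_
  have h₀ : (0 : Part ℕ) = Part.some 0 := rfl
  ext k
  have h₁ : (∃ x, x ∈ Nat.rfind fun m => (fun k => decide (k = 0)) <$>
      membershipOracle T (Nat.pair n m)) ↔ ∃ m, Nat.pair n m ∉ T := by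
    refine Part.dom_iff_mem.symm.trans (Nat.rfind_dom.trans ?_)
    simp [membershipOracle]
  simp only [Part.bind_eq_bind, Part.mem_bind_iff, h₀, Part.mem_some_iff, exists_and_right, h₁]
  have h₂ : (∃ x : Unit, k = Encodable.encode x) ↔ k = 0 := ⟨fun ⟨_, h⟩ => h, fun h => ⟨(), h⟩⟩
  simp [eq_comm, h₂]

theorem REIn.rePred {T S : Set ℕ} (hT : ComputablePred fun n => n ∈ T) (h : REIn T S) :
    REPred fun n => n ∈ S := by
  refine Nat.RecursiveIn.partrec_of_oracle ?_ h
  rintro _ rfl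
  obtain ⟨f, hf, hfT⟩ := ComputablePred.computable_iff.1 hT
  have h' : Computable fun n => cond (f n) 1 0 :=
    Computable.cond hf (Computable.const 1) (Computable.const 0)
  refine (Partrec.nat_iff.1 h').of_eq fun n => ?_
  have := congrFun hfT n
  simp only [eq_iff_iff] at this
  cases hn : f n <;> simp [membershipOracle, this, hn]

theorem ArithmeticalSigma.exists_not_mem {i : ℕ} {T : Set ℕ} (h : ArithmeticalSigma i T) :
    ArithmeticalSigma (i + 1) {n | ∃ m, Nat.pair n m ∉ T} := by
  cases i with
  | zero => exact REIn.rePred h (.exists_not_mem T)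
  | succ i => exact ⟨T, h, .exists_not_mem T⟩

variable {A : Type u}

/-- Greedy matching decides embeddability: each letter of `v` removes the head of what remains of
`u` whenever they agree. -/
theorem foldl_eq_nil_iff_sublist [DecidableEq A] (u v : List A) :
    v.foldl (fun u s => if u.head? = some s then u.tail else u) u = [] ↔ u.Sublist v := by
  induction v generalizing u with
  | nil => simp
  | cons s v ih =>
    rw [List.foldl_cons, ih]
    cases u with
    | nil => simp
    | cons r u =>
      by_cases h : r = s
      · subst h
        simp
      · simp only [List.head?_cons, Option.some.injEq, h, if_false]
        refine ⟨fun h => h.cons _, fun h' => ?_⟩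
        cases h' with
        | cons _ h' => exact h'
        | cons_cons => exact absurd rfl h

variable [Primcodable A]

theorem primrecRel_sublist : PrimrecRel fun u v : List A => u.Sublist v := by
  classical
  have h : Primrec₂ fun (_ : List A × List A) (z : List A × A) =>
      if z.1.head? = some z.2 then z.1.tail else z.1 := by
    have h₁ : Primrec fun z : (List A × List A) × (List A × A) => z.2.1 :=
      Primrec.fst.comp Primrec.snd
    have h₂ : Primrec fun z : (List A × List A) × (List A × A) => z.2.2 :=
      Primrec.snd.comp Primrec.snd
    exact Primrec.ite (Primrec.eq.comp (Primrec.list_head?.comp h₁) (Primrec.option_some.comp h₂))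
      (Primrec.list_tail.comp h₁) h₁
  exact (PrimrecRel.comp Primrec.eq (Primrec.list_foldl Primrec.snd Primrec.fst h)
    (Primrec.const [])).of_eq fun p => foldl_eq_nil_iff_sublist p.1 p.2

variable {ι : Type}

theorem primrec_realize_term {n : ℕ} (τ : subwordLanguage[[List A]].Term (ι ⊕ Fin n))
    {t : ℕ → ι → List A} (ht : ∀ x, Primrec fun s => t s x) (xs : Fin n → List A) :
    Primrec fun s => τ.realize (Sum.elim (t s) xs) := by
  cases τ with
  | var x =>
    cases x with
    | inl x => exact ht x
    | inr x => exact Primrec.const _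
  | @func m f ts =>
    rcases f with f | f
    · exact f.elim
    · cases m with
      | zero =>
        exact Primrec.const _
      | succ m => exact f.elim

theorem primrecPred_realize {n : ℕ} {φ : subwordLanguage[[List A]].BoundedFormula ι n}
    (hφ : φ.IsQF) {t : ℕ → ι → List A} (ht : ∀ x, Primrec fun s => t s x)
    (xs : Fin n → List A) : PrimrecPred fun s => φ.Realize (t s) xs := by
  induction hφ with
  | falsum =>
    have h : PrimrecPred fun s : ℕ => s < 0 := PrimrecRel.comp Primrec.nat_lt Primrec.id
      (Primrec.const 0)
    exact h.of_eq fun s => by simp [Language.BoundedFormula.Realize]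
  | of_isAtomic h =>
    cases h with
    | equal τ σ =>
      classical
      exact (PrimrecRel.comp Primrec.eq (primrec_realize_term τ ht xs)
        (primrec_realize_term σ ht xs)).of_eq fun s => Iff.rfl
    | rel r ts =>
      rcases r with r | r
      · cases r
        exact (primrecRel_sublist.comp (primrec_realize_term (ts 0) ht xs)
          (primrec_realize_term (ts 1) ht xs)).of_eq fun s => Iff.rfl
      · exact r.elim
  | imp _ _ h₁ h₂ =>
    exact (h₁.not.or h₂).of_eq fun s => by
      rw [Language.BoundedFormula.realize_imp, imp_iff_not_or]

theorem SigDef.arithmeticalSigma {i : ℕ} {R : (ι → List A) → Prop} (h : SigDef i R)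
    {t : ℕ → ι → List A} (ht : ∀ x, Primrec fun s => t s x) :
    ArithmeticalSigma i {n | R (t n)} := by
  induction i generalizing ι with
  | zero =>
    obtain ⟨φ, hφ, e⟩ := h
    exact (primrecPred_realize hφ ht _).computablePred.of_eq fun n => e (t n)
  | succ i ih =>
    obtain ⟨κ, hκ, R', hR', e⟩ := h
    obtain ⟨m, ⟨f⟩⟩ := Finite.exists_equiv_fin κ
    -- The quantifier block is packed into the second component of a pair. Numbers that are not
    -- codes decode to a default tuple, which is harmless under an existential quantifier.
    have h := ArithmeticalSigma.exists_not_mem (ih hR' (t := fun s => Sum.elim (t s.unpair.1)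
      fun x => decodeD (Fin m → List A) s.unpair.2 (f x)) ?_)
    · convert h using 1
      ext n
      simp only [Set.mem_ofPred_eq, Nat.unpair_pair, e]
      constructor
      · rintro ⟨w, hw⟩
        refine ⟨@Encodable.encode (Fin m → List A) Primcodable.toEncodable (w ∘ f.symm), ?_⟩
        rw [decodeD_encode]
        simpa using hw
      · rintro ⟨m, hm⟩
        exact ⟨_, hm⟩
    · rintro (x | x)
      · exact (ht x).comp (Primrec.fst.comp Primrec.unpair)
      · exact Primrec.fin_app.comp ((primrec_decodeD _).comp (Primrec.snd.comp Primrec.unpair))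
          (Primrec.const _)

theorem SigDef.inSigmaZero [Nonempty A] {i k : ℕ} {R : Set (Fin k → List A)}
    (h : SigDef i fun v => v ∈ R) : InSigmaZero i R := by
  obtain ⟨a⟩ := ‹Nonempty A›
  let D := decodeD (Fin k → List A)
  -- The default of `decodeD` could put numbers that code nothing into the set. The additional
  -- variable carries a flag, empty exactly when the number is the code of its decoded tuple, so
  -- this decidable test enters without raising the level, even at level 0.
  have h' : SigDef i fun v : Option (Fin k) → List A => v none = [] ∧ v ∘ some ∈ R :=
    .and (.eq_const _ _) (h.reindex some)
  have h'' := h'.arithmeticalSigma (t := fun n x => x.elim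
    (if @Encodable.encode _ Primcodable.toEncodable (D n) = n then [] else [a]) (D n)) ?_
  · unfold InSigmaZero
    convert h'' using 1
    ext n
    constructor
    · rintro ⟨u, hu, rfl⟩
      have : D (@Encodable.encode _ Primcodable.toEncodable u) = u := decodeD_encode u
      refine ⟨?_, ?_⟩
      · simp [this]
      · change D _ ∈ R
        rwa [this]
    · rintro ⟨h₁, h₂⟩
      refine ⟨D n, h₂, ?_⟩
      simpa using h₁
  · have hD : Primrec D := primrec_decodeD _
    rintro (_ | x)
    · exact Primrec.ite (Primrec.eq.comp (Primrec.encode.comp hD) Primrec.id) (Primrec.const [])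
        (Primrec.const [a])
    · exact Primrec.fin_app.comp hD (Primrec.const x)

end Definable

theorem corollary2p2 {A : Type*} [Fintype A] [Primcodable A] (hA : 3 ≤ Fintype.card A)
    (i : ℕ) (hi : 1 ≤ i) (k : ℕ) (R : Set (Fin k → List A)) :
    SigmaDefinable i R ↔ InSigmaZero i R := by
  classical
  have h₁ : Nontrivial A := Fintype.one_lt_card_iff_nontrivial.1 (by omega)
  have : HasThirdLetter A := by
    refine ⟨h₁, fun p q => ?_⟩
    obtain ⟨r, hr⟩ := Finset.exists_mem_notMem_of_card_lt_card (s := {p, q}) (t := Finset.univ)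
      (Finset.card_le_two.trans_lt hA)
    exact ⟨r, by simpa using hr⟩
  obtain ⟨i, rfl⟩ := Nat.exists_eq_add_of_le' hi
  rw [sigmaDefinable_iff_sigDef]
  exact ⟨SigDef.inSigmaZero, SigDef.of_inSigmaZero⟩
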